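/- **Definitions.** A fusion system over a finite $p$-group $S$ is a category $\mathcal F$ whose objects are the subgroups of $S$ and whose morphism sets $\mathrm{Hom}_{\mathcal F}(P,Q)$ consist of injective homomorphisms $P\to Q$ and contain all homomorphisms $P\to Q$ induced by conjugation in $S$, such that each morphism is an $\mathcal F$-isomorphism followed by an inclusion. Subgroups are $\mathcal F$-conjugate if they are isomorphic in $\mathcal F$. A subgroup $P\le S$ is fully centralized (fully normalized) in $\mathcal F$ if $|C_S(P)|\ge|C_S(P')|$ (respectively $|N_S(P)|\ge|N_S(P')|$) for each $P'$ that is $\mathcal F$-conjugate to $P$. $\mathcal F$ is saturated if (I) each fully normalized $P\le S$ is fully centralized and satisfies $\mathrm{Aut}_S(P)\in\mathrm{Syl}_p(\mathrm{Aut}_{\mathcal F}(P))$; and (II) each $\varphi\in\mathrm{Hom}_{\mathcal F}(P,S)$ such that $\varphi(P)$ is fully centralized extends to a morphism in $\mathrm{Hom}_{\mathcal F}(N_\varphi,S)$, where $N_\varphi=\{g\in N_S(P)\mid \varphi c_g\varphi^{-1}\in\mathrm{Aut}_S(\varphi(P))\}$. For a finite group $G$ and $S\in\mathrm{Syl}_p(G)$,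 $\mathrm{Hom}_G(P,Q)$ is the set of homomorphisms $P\to Q$ induced by conjugation by elements of $G$ (similarly for $\mathrm{Iso}_G$, $\mathrm{Aut}_G$, and for a subgroup of $G$ in place of $G$), and $\mathcal F_S(G)$ is the fusion system over $S$ with these morphisms. For $S_0\le S$ and $\Gamma\le\mathrm{Aut}(S_0)$, $\langle\mathcal F_S(G);\mathcal F_{S_0}(\Gamma)\rangle$ is the smallest fusion system over $S$ containing $\mathcal F_S(G)$ and all restrictions of automorphisms in $\Gamma$ to subgroups of $S_0$; its morphisms are the composites of homomorphisms, each of which lies in some $\mathrm{Hom}_G(P,Q)$ with $P,Q\le S$ or is the restriction $P\to\gamma(P)$ of some $\gamma\in\Gamma$ to some $P\le S_0$. If $T\in\mathrm{Syl}_p(H)$, an automorphism $\gamma\in\mathrm{Aut}(T)$ preserves $H$-fusion if for all $P,Q\le T$ and each isomorphism $\alpha\colon P\to Q$, $\alpha\in\mathrm{Iso}_H(P,Q)$ if and only if $\gamma\alpha\gamma^{-1}\in\mathrm{Iso}_H(\gamma(P),\gamma(Q))$. **Proposition.** Fix a finite group $G$, a prime $p$ dividing $|G|$, and a Sylow $p$-subgroup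 $S\in\mathrm{Syl}_p(G)$. Fix a normal subgroup $Z\trianglelefteq G$ of order $p$, an elementary abelian subgroup $U\trianglelefteq S$ of rank two containing $Z$ such that $C_S(U)\in\mathrm{Syl}_p(C_G(U))$, and a group $\Gamma\le\mathrm{Aut}(C_S(U))$ of automorphisms which preserve $C_G(U)$-fusion and such that $\gamma(U)=U$ for all $\gamma\in\Gamma$. Set $S_0=C_S(U)$ and $\mathcal F=\langle\mathcal F_S(G);\mathcal F_{S_0}(\Gamma)\rangle$, and assume the following hold. (a) All subgroups of order $p$ in $S$ different from $Z$ are $G$-conjugate. (b) $\Gamma$ permutes transitively the subgroups of order $p$ in $U$. (c) $\{\varphi\in\Gamma\mid\varphi(Z)=Z\}=\mathrm{Aut}_{N_G(U)}(C_S(U))$. (d) For each $E\le S$ which is elementary abelian of rank three, contains $U$, and is fully centralized in $\mathcal F_S(G)$, $$\{\alpha\in\mathrm{Aut}_{\mathcal F}(C_S(E))\mid\alpha(Z)=Z\}=\mathrm{Aut}_G(C_S(E)).$$ (e) For all $E,E'\le S$ which are elementary abelian of rank three and contain $U$, if $E'=\gamma(E)$ for some $\gamma\in\Gamma$, then $E$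 and $E'$ are $G$-conjugate. Then $\mathcal F$ is a saturated fusion system over $S$. Also, for any $P\le S$ such that $Z\le P$, $$\{\varphi\in\mathrm{Hom}_{\mathcal F}(P,S)\mid\varphi(Z)=Z\}=\mathrm{Hom}_G(P,S).$$ -/

import Mathlib

universe u

/-- A fusion system over a `p`-group `S`: a category whose objects are the subgroups of `S` and
whose morphisms are injective group homomorphisms, containing all homomorphisms induced by
conjugation in `S`, and such that every morphism is the composite of an isomorphism of the category
followed by an inclusion. (Identities belong to the category by `conj_mem` with `s = 1`.) -/
structure FusionSystem (p : ℕ) (S : Type u) [Group S] where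
  /-- `Hom P Q` is the set of morphisms from `P` to `Q`. -/
  Hom : (P Q : Subgroup S) → Set (P →* Q)
  isPGroup : IsPGroup p S
  comp_mem : ∀ {P Q R : Subgroup S} {φ : P →* Q} {ψ : Q →* R},
    φ ∈ Hom P Q → ψ ∈ Hom Q R → ψ.comp φ ∈ Hom P R
  conj_mem : ∀ {P Q : Subgroup S} (φ : P →* Q) (s : S),
    (∀ x : P, (φ x : S) = s * x * s⁻¹) → φ ∈ Hom P Q
  injective : ∀ {P Q : Subgroup S} {φ : P →* Q}, φ ∈ Hom P Q → Function.Injective φ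
  exists_factor : ∀ {P Q : Subgroup S} {φ : P →* Q}, φ ∈ Hom P Q →
    ∃ (R : Subgroup S) (hR : R ≤ Q) (e : P ≃* R),
      e.toMonoidHom ∈ Hom P R ∧ e.symm.toMonoidHom ∈ Hom R P ∧
      φ = (Subgroup.inclusion hR).comp e.toMonoidHom

/-- `H ∈ Syl_p(K)`, for subgroups `H` and `K` of a common group. -/
def IsSylowIn {G : Type u} [Group G] (p : ℕ) (H K : Subgroup G) : Prop :=
  H ≤ K ∧ ∃ T : Sylow p K, T.toSubgroup = H.subgroupOf K

/-- `A` is elementary abelian of rank `n`, i.e. isomorphic to `(ℤ/p)ⁿ`. -/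
def IsElementaryAbelianOfRank {G : Type u} [Group G] (p n : ℕ) (A : Subgroup G) : Prop :=
  (∀ x ∈ A, ∀ y ∈ A, x * y = y * x) ∧ (∀ x ∈ A, x ^ p = 1) ∧ Nat.card A = p ^ n

/-- The image `φ(A)`, as a subgroup of `S`, where `φ` is a homomorphism between subgroups `P` and
`Q` of `S` and `A ≤ P`. -/
def imageUnder {S : Type u} [Group S] {P Q : Subgroup S} (φ : P →* Q) (A : Subgroup S) :
    Subgroup S :=
  (A.subgroupOf P).map (Q.subtype.comp φ)

/-- `Aut_S(P)`: the automorphisms of `P` induced by conjugation by the elements of `N_S(P)`. -/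
def autConj {S : Type u} [Group S] (P : Subgroup S) : Subgroup (MulAut P) :=
  P.normalizerMonoidHom.range

/-- For an isomorphism `e : P ≃ R` between subgroups of `S`, the group
`N_e = {g ∈ N_S(P) | e c_g e⁻¹ ∈ Aut_S(R)}`. -/
def extensionSubgroup {S : Type u} [Group S] {P R : Subgroup S} (e : P ≃* R) : Subgroup S :=
  ((autConj R).comap ((MulAut.congr e).toMonoidHom.comp P.normalizerMonoidHom)).map
    (Subgroup.normalizer (P : Set S)).subtype

namespace FusionSystem

variable {p : ℕ} {S : Type u} [Group S] (F : FusionSystem p S)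

/-- `e` is an isomorphism in the category `F`. -/
def IsIso {P Q : Subgroup S} (e : P ≃* Q) : Prop :=
  e.toMonoidHom ∈ F.Hom P Q ∧ e.symm.toMonoidHom ∈ F.Hom Q P

/-- `P` and `Q` are `F`-conjugate. -/
def Conj (P Q : Subgroup S) : Prop :=
  ∃ e : P ≃* Q, F.IsIso e

/-- `Aut_F(P)`: the automorphisms of `P` in the category `F`. -/
def Aut (P : Subgroup S) : Subgroup (MulAut P) where
  carrier := {α | F.IsIso α}
  one_mem' := ⟨F.conj_mem _ 1 (by intro x; simp), F.conj_mem _ 1 (by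
    intro x; rw [inv_one, one_mul, mul_one]; rfl)⟩
  mul_mem' := by
    intro α β hα hβ
    exact ⟨F.comp_mem hβ.1 hα.1, F.comp_mem hα.2 hβ.2⟩
  inv_mem' := by
    intro α hα
    exact ⟨hα.2, hα.1⟩

/-- `P` is fully centralized in `F` (`S` being finite). -/
def FullyCentralized (P : Subgroup S) : Prop :=
  ∀ P' : Subgroup S, F.Conj P P' →
    Nat.card (Subgroup.centralizer (P' : Set S)) ≤ Nat.card (Subgroup.centralizer (P : Set S))

/-- `P` is fully normalized in `F` (`S` being finite). -/
def FullyNormalized (P : Subgroup S) : Prop :=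
  ∀ P' : Subgroup S, F.Conj P P' →
    Nat.card (Subgroup.normalizer (P' : Set S)) ≤ Nat.card (Subgroup.normalizer (P : Set S))

/-- The fusion system `F` over the finite `p`-group `S` is saturated. In the second condition
`e : P ≃ R` is the morphism `φ : P → S` regarded as an isomorphism onto its image `R = φ(P)`. -/
structure IsSaturated : Prop where
  sylow : ∀ P : Subgroup S, F.FullyNormalized P →
    F.FullyCentralized P ∧ IsSylowIn p (autConj P) (F.Aut P)
  extend : ∀ (P R : Subgroup S) (φ : P →* (⊤ : Subgroup S)) (e : P ≃* R),
    φ ∈ F.Hom P ⊤ → (∀ x : P, (e x : S) = φ x) → F.FullyCentralized R →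
    ∃ φ' ∈ F.Hom (extensionSubgroup e) ⊤,
      ∀ (x : S) (hx : x ∈ P) (hx' : x ∈ extensionSubgroup e), φ' ⟨x, hx'⟩ = φ ⟨x, hx⟩

end FusionSystem

/-- Let `ι : T → G` be an (injective) homomorphism, through which `T` is regarded as a subgroup of
`G`, and let `H ≤ G`. Then `conjHom ι H P Q` is `Hom_H(P, Q)`: the set of the homomorphisms `P → Q`
of the form `x ↦ g x g⁻¹` for some `g ∈ H`. -/
def conjHom {T : Type u} {G : Type u} [Group T] [Group G] (ι : T →* G) (H : Subgroup G)
    (P Q : Subgroup T) : Set (P →* Q) :=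
  {φ | ∃ g ∈ H, ∀ x : P, ι (φ x) = g * ι x * g⁻¹}

/-- The subgroups `A` and `B` of `T ≤ G` are conjugate in `G`. -/
def AreConj {T : Type u} {G : Type u} [Group T] [Group G] (ι : T →* G) (A B : Subgroup T) : Prop :=
  ∃ g : G, (A.map ι).map (MulAut.conj g).toMonoidHom = B.map ι

/-- `γ ∈ Aut(T)` preserves `H`-fusion: for all `P, Q ≤ T`, an isomorphism `α : P → Q` belongs to
`Iso_H(P, Q)` if and only if `γ α γ⁻¹` belongs to `Iso_H(γ(P), γ(Q))`. -/
def PreservesFusion {T : Type u} {G : Type u} [Group T] [Group G] (ι : T →* G) (H : Subgroup G)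
    (γ : MulAut T) : Prop :=
  ∀ (P Q : Subgroup T) (α : P ≃* Q),
    α.toMonoidHom ∈ conjHom ι H P Q ↔
      ((MulEquiv.subgroupMap γ P).symm.trans
        (α.trans (MulEquiv.subgroupMap γ Q))).toMonoidHom ∈ conjHom ι H _ _

/-- The fusion system `F_S(G)` of a finite group `G` over a Sylow `p`-subgroup `S`. -/
def groupFusion {G : Type u} [Group G] {p : ℕ} (S : Sylow p G) :
    FusionSystem p S.toSubgroup where
  Hom := conjHom S.toSubgroup.subtype ⊤
  isPGroup := S.isPGroup'
  comp_mem := by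
    rintro P Q R φ ψ ⟨g, -, hg⟩ ⟨h, -, hh⟩
    refine ⟨h * g, trivial, fun x => ?_⟩
    rw [MonoidHom.comp_apply, hh, hg]
    group
  conj_mem := by
    intro P Q φ s hs
    refine ⟨s, trivial, fun x => ?_⟩
    rw [hs]
    simp
  injective := by
    rintro P Q φ ⟨g, -, hg⟩ x y hxy
    have h := hg x
    rw [hxy, hg y] at h
    exact Subtype.ext (Subtype.ext (by simpa using h.symm))
  exists_factor := by
    rintro P Q φ ⟨g, -, hg⟩
    have hinj : Function.Injective (Q.subtype.comp φ) := by
      intro x y hxy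
      have h := hg x
      have hxy' : φ x = φ y := Subtype.ext hxy
      rw [hxy', hg y] at h
      exact Subtype.ext (Subtype.ext (by simpa using h.symm))
    have he : ∀ x, ((MonoidHom.ofInjective hinj x : (Q.subtype.comp φ).range) : S.toSubgroup)
        = φ x := fun x => rfl
    refine ⟨(Q.subtype.comp φ).range, ?_, MonoidHom.ofInjective hinj, ⟨g, trivial, fun x => ?_⟩,
      ⟨g⁻¹, trivial, fun y => ?_⟩, ?_⟩
    · rintro _ ⟨x, rfl⟩
      exact (φ x).2
    · exact hg x
    · obtain ⟨x, rfl⟩ := (MonoidHom.ofInjective hinj).surjective y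
      change _ = g⁻¹ * S.toSubgroup.subtype (φ x) * g⁻¹⁻¹
      rw [hg]
      simp [mul_assoc]
    · ext x
      rfl

/-- The homomorphisms `P → Q` between subgroups of `S` that are composites of morphisms of `F` and
of isomorphisms `P' → γ(P') = Q'` that are restrictions of automorphisms `γ ∈ Γ` of the subgroup
`S₀ ≤ S` (where `P', Q' ≤ S₀`). -/
inductive GenHom {p : ℕ} {S : Type u} [Group S] (F : FusionSystem p S) (S₀ : Subgroup S)
    (Γ : Subgroup (MulAut S₀)) : (P Q : Subgroup S) → (P →* Q) → Prop
  | base {P Q : Subgroup S} (φ : P →* Q) : φ ∈ F.Hom P Q → GenHom F S₀ Γ P Q φ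
  | restr {P Q : Subgroup S} (hP : P ≤ S₀) (hQ : Q ≤ S₀) (φ : P →* Q) (γ : MulAut S₀) :
      γ ∈ Γ → Function.Surjective φ →
      (∀ x : P, Subgroup.inclusion hQ (φ x) = γ (Subgroup.inclusion hP x)) → GenHom F S₀ Γ P Q φ
  | comp {P Q R : Subgroup S} (φ : P →* Q) (ψ : Q →* R) :
      GenHom F S₀ Γ P Q φ → GenHom F S₀ Γ Q R ψ → GenHom F S₀ Γ P R (ψ.comp φ)

theorem GenHom.factor {p : ℕ} {S : Type u} [Group S] {F : FusionSystem p S} {S₀ : Subgroup S}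
    {Γ : Subgroup (MulAut S₀)} {P Q : Subgroup S} {φ : P →* Q} (hφ : GenHom F S₀ Γ P Q φ) :
    ∀ (P' : Subgroup S) (hP' : P' ≤ P), ∃ (R : Subgroup S) (hR : R ≤ Q) (e : P' ≃* R),
      GenHom F S₀ Γ P' R e.toMonoidHom ∧ GenHom F S₀ Γ R P' e.symm.toMonoidHom ∧
      φ.comp (Subgroup.inclusion hP') = (Subgroup.inclusion hR).comp e.toMonoidHom := by
  induction hφ with
  | base φ hφ =>
    intro P' hP'
    have hi : Subgroup.inclusion hP' ∈ F.Hom _ _ := F.conj_mem _ 1 (by intro x; simp)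
    obtain ⟨R, hR, e, h1, h2, h3⟩ := F.exists_factor (F.comp_mem hi hφ)
    exact ⟨R, hR, e, .base _ h1, .base _ h2, h3⟩
  | @restr P Q hP hQ φ γ hγ hs hφ =>
    intro P' hP'
    have hinj : Function.Injective ((Q.subtype.comp φ).comp (Subgroup.inclusion hP')) := by
      intro x y hxy
      have h : φ (Subgroup.inclusion hP' x) = φ (Subgroup.inclusion hP' y) := Subtype.ext hxy
      have h' := hφ (Subgroup.inclusion hP' x)
      rw [h, hφ] at h'
      exact (Subgroup.inclusion_injective hP'
        (Subgroup.inclusion_injective hP (γ.injective h'))).symm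
    have hR : ((Q.subtype.comp φ).comp (Subgroup.inclusion hP')).range ≤ Q := by
      rintro _ ⟨x, rfl⟩
      exact (φ _).2
    have hkey : ∀ x : P', Subgroup.inclusion (hR.trans hQ) (MonoidHom.ofInjective hinj x) =
        γ (Subgroup.inclusion (hP'.trans hP) x) := fun x => hφ (Subgroup.inclusion hP' x)
    refine ⟨_, hR, MonoidHom.ofInjective hinj,
      .restr (hP'.trans hP) (hR.trans hQ) _ γ hγ (MonoidHom.ofInjective hinj).surjective hkey,
      .restr (hR.trans hQ) (hP'.trans hP) _ γ⁻¹ (Γ.inv_mem hγ)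
        (MonoidHom.ofInjective hinj).symm.surjective fun y => ?_, ?_⟩
    · obtain ⟨x, rfl⟩ := (MonoidHom.ofInjective hinj).surjective y
      rw [hkey]
      simp
    · ext x
      rfl
  | comp φ ψ _ _ ih1 ih2 =>
    intro P' hP'
    obtain ⟨R₁, hR₁, e₁, h1, h2, h3⟩ := ih1 P' hP'
    obtain ⟨R₂, hR₂, e₂, k1, k2, k3⟩ := ih2 R₁ hR₁
    refine ⟨R₂, hR₂, e₁.trans e₂, .comp _ _ h1 k1, .comp _ _ k2 h2, ?_⟩
    rw [MonoidHom.comp_assoc, h3, ← MonoidHom.comp_assoc, k3]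
    rfl

/-- The fusion system `⟨F; F_{S₀}(Γ)⟩` over `S` generated by `F` and by all restrictions of the
automorphisms in `Γ ≤ Aut(S₀)`. It is the smallest one that contains them: see
`generatedFusion_le`. -/
def generatedFusion {p : ℕ} {S : Type u} [Group S] (F : FusionSystem p S) (S₀ : Subgroup S)
    (Γ : Subgroup (MulAut S₀)) : FusionSystem p S where
  Hom P Q := {φ | GenHom F S₀ Γ P Q φ}
  isPGroup := F.isPGroup
  comp_mem := fun hφ hψ => .comp _ _ hφ hψ
  conj_mem := fun φ s hs => .base φ (F.conj_mem φ s hs)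
  injective := by
    intro P Q φ hφ
    induction hφ with
    | base φ hφ => exact F.injective hφ
    | restr hP hQ φ γ hγ hs hφ =>
      intro x y hxy
      have h := hφ x
      rw [hxy, hφ] at h
      exact (Subgroup.inclusion_injective hP (γ.injective h)).symm
    | comp φ ψ _ _ ih1 ih2 => exact ih2.comp ih1
  exists_factor := by
    intro P Q φ hφ
    obtain ⟨R, hR, e, h1, h2, h3⟩ := GenHom.factor hφ P le_rfl
    exact ⟨R, hR, e, h1, h2, h3⟩

theorem generatedFusion_le {p : ℕ} {S : Type u} [Group S] (F : FusionSystem p S) (S₀ : Subgroup S)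
    (Γ : Subgroup (MulAut S₀)) (E : FusionSystem p S) (hF : ∀ P Q, F.Hom P Q ⊆ E.Hom P Q)
    (hΓ : ∀ (P Q : Subgroup S) (hP : P ≤ S₀) (hQ : Q ≤ S₀) (φ : P →* Q), ∀ γ ∈ Γ,
      (∀ x : P, Subgroup.inclusion hQ (φ x) = γ (Subgroup.inclusion hP x)) → φ ∈ E.Hom P Q)
    (P Q : Subgroup S) : (generatedFusion F S₀ Γ).Hom P Q ⊆ E.Hom P Q := by
  intro φ hφ
  induction hφ with
  | base φ hφ => exact hF _ _ hφ
  | restr hP hQ φ γ hγ _ hφ => exact hΓ _ _ hP hQ φ γ hγ hφ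
  | comp φ ψ _ _ ih1 ih2 => exact E.comp_mem ih1 ih2

/-! Two facts carry the theorem: a criterion that lifts saturation from `F_S(G)` to `F`, and the
fact that an `F`-morphism mapping `Z` to itself comes from `G`.

Criterion (`IsCentralReduction.isSaturated`). Suppose the central subgroup `Z` has order `p`, the
`F`-morphisms that are defined on a subgroup containing `Z` and preserve `Z` lie in a saturated `F₀
⊆ F`, and every `a` of order `p` is moved into `Z` by an `F`-morphism defined on all of `C_S(a)`. A
`p`-group of automorphisms of `P ≠ 1` fixes some `a ∈ P` of order `p`. Moving `a` into `Z` carries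
along whatever centralizes `a`, including the relevant normalizers and centralizers, and turns each
saturation axiom for `F` into one for `F₀`. For `F₀ = F_S(G)`, saturation is Sylow's theorem
(`groupFusion_isSaturated`). The morphism on `C_S(a)` is a conjugation taking `a` into `U` by (a)
and `C_S(a)` into `S₀`, followed by an element of `Γ` chosen by (b).

Morphisms preserving `Z` (`groupFusion_mor`). A morphism of `F` is a long composite whose
intermediate maps may move `Z`. Attach to each `a` of order `p` its standard maps into `Z`: a
conjugation if `a ∈ Z`, and otherwise conjugation, then `Γ`, then conjugation. By (c) and
preservation of `C_G(U)`-fusion they are unique up to a final conjugation (`isTransport_unique`), so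
the property "standard maps composed with `k` are standard" passes to composites of such `k`
(`isCompatible_comp`). It holds for conjugations. For `γ ∈ Γ` it follows from (b) and (c) when `a ∈
U`. When `a ∉ U`, put `E = ⟨a⟩U`, of rank three: by (e) the maps involved become automorphisms of
`C_S(E)`, and (d) identifies the discrepancy, which fixes `Z`, with a conjugation. If a composite
sends some `1 ≠ z ∈ Z` into `Z`, the standard maps at both ends are conjugations, so the composite
is one too. -/

open Subgroup

/-! ### Sylow subgroups of subgroups of a common group -/

section Sylow

variable {G : Type u} [Group G] {p : ℕ}

/-- Maximality among the `p`-subgroups of `K`, phrased inside `G` so that later arguments need no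
subgroups of subtypes. -/
theorem isSylowIn_iff {H K : Subgroup G} : IsSylowIn p H K ↔
    H ≤ K ∧ IsPGroup p H ∧ ∀ D ≤ K, IsPGroup p D → H ≤ D → D ≤ H := by
  constructor
  · rintro ⟨hHK, T, hT⟩
    refine ⟨hHK, ?_, fun D hD hDp hHD => ?_⟩
    · have h := T.isPGroup'
      rw [hT] at h
      exact h.of_equiv (subgroupOfEquivOfLe hHK)
    · have h : D.subgroupOf K = T.toSubgroup :=
        T.is_maximal' (hDp.of_equiv (subgroupOfEquivOfLe hD).symm)
          (hT ▸ fun x hx => hHD hx)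
      intro x hx
      have hx' : (⟨x, hD hx⟩ : K) ∈ D.subgroupOf K := hx
      rw [h, hT] at hx'
      exact hx'
  · rintro ⟨hHK, hp, hmax⟩
    refine ⟨hHK, ⟨H.subgroupOf K, hp.of_equiv (subgroupOfEquivOfLe hHK).symm, ?_⟩, rfl⟩
    intro Q hQ hle
    refine le_antisymm (fun x hx => ?_) hle
    refine hmax (Q.map K.subtype) (map_subtype_le Q) (hQ.map _) (fun y hy => ?_)
      (mem_map_of_mem K.subtype hx)
    exact ⟨⟨y, hHK hy⟩, hle hy, rfl⟩

theorem exists_isSylowIn_ge {D K : Subgroup G} (hD : IsPGroup p D) (hDK : D ≤ K) :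
    ∃ T, D ≤ T ∧ IsSylowIn p T K := by
  obtain ⟨T, hT⟩ := (hD.of_equiv (subgroupOfEquivOfLe hDK).symm).exists_le_sylow
  refine ⟨T.toSubgroup.map K.subtype, fun x hx => ⟨⟨x, hDK hx⟩, hT hx, rfl⟩,
    map_subtype_le _, T, ?_⟩
  exact (comap_map_eq_self_of_injective K.subtype_injective _).symm

/-- If `H ⊓ K` is a Sylow subgroup of `K` and `L ⊆ K H`, then `H` is a Sylow subgroup of `L`. -/
theorem isSylowIn_of_inter {H K L : Subgroup G} (hHL : H ≤ L) (hH : IsPGroup p H)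
    (hK : IsSylowIn p (H ⊓ K) K) (hL : ∀ l ∈ L, ∃ h ∈ H, l * h⁻¹ ∈ K) : IsSylowIn p H L := by
  refine isSylowIn_iff.2 ⟨hHL, hH, fun D hD hDp hHD d hd => ?_⟩
  obtain ⟨h, hh, hk⟩ := hL d (hD hd)
  have := (isSylowIn_iff.1 hK).2.2 (D ⊓ K) inf_le_right (hDp.to_le inf_le_left)
    (inf_le_inf_right K hHD) ⟨D.mul_mem hd (D.inv_mem (hHD hh)), hk⟩
  simpa using H.mul_mem this.1 hh

variable [Finite G] [Fact p.Prime]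

theorem IsSylowIn.exists_conj_mem {H K D : Subgroup G} (h : IsSylowIn p H K) (hDK : D ≤ K)
    (hD : IsPGroup p D) : ∃ k ∈ K, ∀ d ∈ D, k * d * k⁻¹ ∈ H := by
  obtain ⟨hHK, T, hT⟩ := h
  obtain ⟨Q, hQ⟩ := (hD.of_equiv (subgroupOfEquivOfLe hDK).symm).exists_le_sylow
  obtain ⟨k, hk⟩ := MulAction.exists_smul_eq K Q T
  refine ⟨k, k.2, fun d hd => ?_⟩
  have h1 : MulAut.conj k (⟨d, hDK hd⟩ : K) ∈ (k • Q : Sylow p K) :=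
    Subgroup.smul_mem_pointwise_smul _ _ _ (hQ hd)
  rw [hk] at h1
  change _ ∈ T.toSubgroup at h1
  rw [hT] at h1
  exact h1

end Sylow

/-! ### Images of subgroups and elementwise forms of `N_e` and `Aut_S(P)` -/

section ImageUnder

variable {S : Type u} [Group S]

theorem imageUnder_eq_of_forall_mem {P Q A B : Subgroup S} {φ : P →* Q} [Finite B]
    (hA : A ≤ P) (hφ : Function.Injective φ) (h : ∀ x : P, (x : S) ∈ A → (φ x : S) ∈ B)
    (hc : Nat.card B ≤ Nat.card A) : imageUnder φ A = B := by
  have hle : imageUnder φ A ≤ B := by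
    rintro _ ⟨x, hx, rfl⟩
    exact h x hx
  have : Finite (imageUnder φ A) := Finite.of_injective _ (inclusion_injective hle)
  refine eq_of_le_of_card_ge hle (hc.trans (le_of_eq ?_))
  have hinj : Function.Injective (Q.subtype.comp φ) := Q.subtype_injective.comp hφ
  rw [imageUnder, card_map_of_injective hinj]
  exact (Nat.card_congr (subgroupOfEquivOfLe hA).toEquiv).symm

end ImageUnder

/-- The conjugate `g x g⁻¹` appears as a separate `y : P` with an equation, which avoids carrying a
proof that it lies in `P`. -/
theorem mem_extensionSubgroup {S : Type u} [Group S] {P R : Subgroup S} {e : P ≃* R} {g : S} :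
    g ∈ extensionSubgroup e ↔ g ∈ normalizer (P : Set S) ∧ ∃ h ∈ normalizer (R : Set S),
      ∀ x y : P, (y : S) = g * x * g⁻¹ → (e y : S) = h * e x * h⁻¹ := by
  constructor
  · rintro ⟨g, ⟨h, hh⟩, rfl⟩
    refine ⟨g.2, h, h.2, fun x y hy => ?_⟩
    have h1 := DFunLike.congr_fun hh (e x)
    have h2 : y = P.normalizerMonoidHom g x := Subtype.ext hy
    have h3 := congrArg (Subtype.val) h1
    rw [normalizerMonoidHom_apply_apply_coe] at h3
    rw [h3, h2]
    simp [MulAut.congr]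
  · rintro ⟨hg, h, hh, H⟩
    refine ⟨⟨g, hg⟩, ⟨⟨h, hh⟩, ?_⟩, rfl⟩
    ext y
    obtain ⟨x, rfl⟩ := e.surjective y
    have := H x (P.normalizerMonoidHom ⟨g, hg⟩ x) rfl
    simp [MulAut.congr, this]

theorem le_extensionSubgroup {S : Type u} [Group S] {P R : Subgroup S} {e : P ≃* R} :
    P ≤ extensionSubgroup e := fun x hx => mem_extensionSubgroup.2
  ⟨le_normalizer hx, e ⟨x, hx⟩, le_normalizer (e _).2, fun y z hz => by
    rw [show z = ⟨x, hx⟩ * y * ⟨x, hx⟩⁻¹ from Subtype.ext hz]; simp⟩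

theorem mem_autConj {S : Type u} [Group S] {P : Subgroup S} {α : MulAut P} :
    α ∈ autConj P ↔ ∃ g ∈ normalizer (P : Set S), ∀ x : P, (α x : S) = g * x * g⁻¹ := by
  constructor
  · rintro ⟨g, rfl⟩
    exact ⟨g, g.2, fun x => rfl⟩
  · rintro ⟨g, hg, h⟩
    exact ⟨⟨g, hg⟩, by ext x; exact (h x).symm⟩

/-! ### Morphisms of a fusion system as plain functions on `S` -/

namespace FusionSystem

variable {p : ℕ} {S : Type u} [Group S] {F : FusionSystem p S} {P Q R : Subgroup S}

theorem inclusion_mem (h : P ≤ Q) : inclusion h ∈ F.Hom P Q :=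
  F.conj_mem _ 1 (by intro x; simp)

/-- The function `f` restricts to a morphism of `F` from `P` to `S`. -/
def Mor (F : FusionSystem p S) (P : Subgroup S) (f : S → S) : Prop :=
  ∃ φ ∈ F.Hom P ⊤, ∀ x : P, f x = φ x

theorem Mor.of_hom {φ : P →* Q} {f : S → S} (hφ : φ ∈ F.Hom P Q) (h : ∀ x : P, f x = φ x) :
    F.Mor P f :=
  ⟨_, F.comp_mem hφ (inclusion_mem le_top), h⟩

theorem exists_mor {φ : P →* Q} (hφ : φ ∈ F.Hom P Q) : ∃ f, F.Mor P f ∧ ∀ x : P, f x = φ x := by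
  have h : ∀ x : P, Function.extend ((↑) : P → S) (fun x => (φ x : S)) 1 x = φ x := fun x =>
    Subtype.val_injective.extend_apply _ _ x
  exact ⟨_, .of_hom hφ h, h⟩

theorem Mor.exists_equiv {f : S → S} (hf : F.Mor P f) :
    ∃ (R : Subgroup S) (e : P ≃* R), F.IsIso e ∧ ∀ x : P, (e x : S) = f x := by
  obtain ⟨φ, hφ, h⟩ := hf
  obtain ⟨R, hR, e, h1, h2, h3⟩ := F.exists_factor hφ
  refine ⟨R, e, ⟨h1, h2⟩, fun x => ?_⟩
  rw [h, h3]
  rfl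

theorem Mor.exists_equiv_of_image {f : S → S} (hf : F.Mor P f) (h1 : ∀ x ∈ P, f x ∈ Q)
    (h2 : ∀ y ∈ Q, ∃ x ∈ P, f x = y) : ∃ e : P ≃* Q, F.IsIso e ∧ ∀ x : P, (e x : S) = f x := by
  obtain ⟨R, e, he, h⟩ := hf.exists_equiv
  have : R = Q := by
    ext y
    constructor
    · intro hy
      obtain ⟨x, hx⟩ := e.surjective ⟨y, hy⟩
      have := h1 x x.2
      rwa [← h, hx] at this
    · intro hy
      obtain ⟨x, hx, rfl⟩ := h2 y hy
      rw [← h ⟨x, hx⟩]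
      exact (e _).2
  subst this
  exact ⟨e, he, h⟩

theorem Mor.exists_hom {f : S → S} (hf : F.Mor P f) (h1 : ∀ x ∈ P, f x ∈ Q) :
    ∃ φ ∈ F.Hom P Q, ∀ x : P, (φ x : S) = f x := by
  obtain ⟨R, e, he, h⟩ := hf.exists_equiv
  have hR : R ≤ Q := by
    intro y hy
    obtain ⟨x, hx⟩ := e.surjective ⟨y, hy⟩
    have := h1 x x.2
    rwa [← h, hx] at this
  exact ⟨_, F.comp_mem he.1 (inclusion_mem hR), h⟩

theorem Mor.hom_mem {f : S → S} (hf : F.Mor P f) {φ : P →* Q} (h : ∀ x : P, f x = φ x) :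
    φ ∈ F.Hom P Q := by
  obtain ⟨ψ, hψ, h'⟩ := hf.exists_hom (Q := Q) fun x hx => by rw [h ⟨x, hx⟩]; exact (φ _).2
  have : φ = ψ := by
    ext x
    rw [← h, h']
  exact this ▸ hψ

theorem Mor.isIso {f : S → S} (hf : F.Mor P f) {e : P ≃* Q} (h : ∀ x : P, f x = e x) :
    F.IsIso e := by
  obtain ⟨e', he', h'⟩ := hf.exists_equiv_of_image (Q := Q)
    (fun x hx => by rw [h ⟨x, hx⟩]; exact (e _).2) fun y hy => by
      obtain ⟨x, hx⟩ := e.surjective ⟨y, hy⟩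
      exact ⟨x, x.2, by rw [h, hx]⟩
  have : e = e' := by
    ext x
    rw [← h, h']
  exact this ▸ he'

theorem Mor.mono {f : S → S} (hf : F.Mor Q f) (h : P ≤ Q) : F.Mor P f := by
  obtain ⟨φ, hφ, hf⟩ := hf
  exact ⟨_, F.comp_mem (inclusion_mem h) hφ, fun x => hf (inclusion h x)⟩

theorem Mor.congr {f g : S → S} (hf : F.Mor P f) (h : ∀ x ∈ P, g x = f x) : F.Mor P g := by
  obtain ⟨φ, hφ, hf⟩ := hf
  exact ⟨φ, hφ, fun x => (h x x.2).trans (hf x)⟩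

theorem Mor.comp {f g : S → S} (hg : F.Mor Q g) (hf : F.Mor P f) (h : ∀ x ∈ P, f x ∈ Q) :
    F.Mor P (g ∘ f) := by
  obtain ⟨φ, hφ, hf⟩ := hf.exists_hom h
  obtain ⟨ψ, hψ, hg⟩ := hg
  exact ⟨_, F.comp_mem hφ hψ, fun x => by
    rw [Function.comp_apply, ← hf, hg]; rfl⟩

theorem mor_conj (s : S) : F.Mor P (fun x => s * x * s⁻¹) :=
  ⟨((MulAut.conj s).toMonoidHom.comp P.subtype).codRestrict ⊤ (fun _ => trivial),
    F.conj_mem _ s fun _ => rfl, fun _ => rfl⟩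

theorem mor_id : F.Mor P id := (mor_conj 1).congr (by simp)

section

variable {f : S → S} (hf : F.Mor P f)
include hf

theorem Mor.injOn {x y : S} (hx : x ∈ P) (hy : y ∈ P) (h : f x = f y) : x = y := by
  obtain ⟨φ, hφ, hf⟩ := hf
  rw [hf ⟨x, hx⟩, hf ⟨y, hy⟩] at h
  exact congrArg Subtype.val (F.injective hφ (Subtype.ext h))

theorem Mor.map_mul {x y : S} (hx : x ∈ P) (hy : y ∈ P) : f (x * y) = f x * f y := by
  obtain ⟨φ, hφ, hf⟩ := hf
  rw [hf ⟨x, hx⟩, hf ⟨y, hy⟩, hf ⟨x * y, mul_mem hx hy⟩, ← Subgroup.coe_mul, ← _root_.map_mul]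
  rfl

theorem Mor.map_inv {x : S} (hx : x ∈ P) : f x⁻¹ = (f x)⁻¹ := by
  obtain ⟨φ, hφ, hf⟩ := hf
  rw [hf ⟨x, hx⟩, hf ⟨x⁻¹, inv_mem hx⟩, ← Subgroup.coe_inv, ← _root_.map_inv]
  rfl

theorem Mor.map_one : f 1 = 1 := by
  obtain ⟨φ, hφ, hf⟩ := hf
  exact (hf 1).trans (by simp)

theorem Mor.map_conj {x y : S} (hx : x ∈ P) (hy : y ∈ P) :
    f (x * y * x⁻¹) = f x * f y * (f x)⁻¹ := by
  rw [hf.map_mul (mul_mem hx hy) (inv_mem hx), hf.map_mul hx hy, hf.map_inv hx]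

theorem Mor.map_pow {x : S} (hx : x ∈ P) (n : ℕ) : f (x ^ n) = f x ^ n := by
  induction n with
  | zero => simpa using hf.map_one
  | succ n ih => rw [pow_succ, pow_succ, hf.map_mul (pow_mem hx n) hx, ih]

theorem Mor.exists_image : ∃ R : Subgroup S, (∀ x ∈ P, f x ∈ R) ∧ ∀ y ∈ R, ∃ x ∈ P, f x = y := by
  obtain ⟨R, e, -, h⟩ := hf.exists_equiv
  refine ⟨R, fun x hx => h ⟨x, hx⟩ ▸ (e _).2, fun y hy => ?_⟩
  obtain ⟨x, hx⟩ := e.surjective ⟨y, hy⟩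
  exact ⟨x, x.2, by rw [← h, hx]⟩

theorem Mor.exists_inverse (h1 : ∀ x ∈ P, f x ∈ Q) (h2 : ∀ y ∈ Q, ∃ x ∈ P, f x = y) :
    ∃ f', F.Mor Q f' ∧ ∀ x ∈ P, f' (f x) = x := by
  obtain ⟨e, he, h⟩ := hf.exists_equiv_of_image h1 h2
  obtain ⟨f', hf', h'⟩ := exists_mor he.2
  refine ⟨f', hf', fun x hx => ?_⟩
  have := h' (e ⟨x, hx⟩)
  rw [h] at this
  rw [this]
  exact congrArg Subtype.val (e.symm_apply_apply ⟨x, hx⟩)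

theorem Mor.card_le [Finite S] {A B : Subgroup S} (hA : A ≤ P) (h : ∀ x ∈ A, f x ∈ B) :
    Nat.card A ≤ Nat.card B :=
  Nat.card_le_card_of_injective (fun x : A => (⟨f x, h x x.2⟩ : B)) fun x y hxy =>
    Subtype.ext (hf.injOn (hA x.2) (hA y.2) (congrArg Subtype.val hxy))

theorem Mor.surjOn [Finite S] {A B : Subgroup S} (hA : A ≤ P) (h : ∀ x ∈ A, f x ∈ B)
    (hc : Nat.card B ≤ Nat.card A) : ∀ y ∈ B, ∃ x ∈ A, f x = y := by
  have hi : Function.Injective (fun x : A => (⟨f x, h x x.2⟩ : B)) := fun x y hxy =>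
    Subtype.ext (hf.injOn (hA x.2) (hA y.2) (congrArg Subtype.val hxy))
  have hb := hi.bijective_of_nat_card_le hc
  intro y hy
  obtain ⟨x, hx⟩ := hb.2 ⟨y, hy⟩
  exact ⟨x, x.2, congrArg Subtype.val hx⟩

end

theorem conj_iff : F.Conj P Q ↔
    ∃ f, F.Mor P f ∧ (∀ x ∈ P, f x ∈ Q) ∧ ∀ y ∈ Q, ∃ x ∈ P, f x = y := by
  constructor
  · rintro ⟨e, he⟩
    obtain ⟨f, hf, h⟩ := exists_mor he.1
    refine ⟨f, hf, fun x hx => (h ⟨x, hx⟩).symm ▸ (e _).2, fun y hy => ?_⟩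
    obtain ⟨x, hx⟩ := e.surjective ⟨y, hy⟩
    exact ⟨x, x.2, (h x).trans (congrArg Subtype.val hx)⟩
  · rintro ⟨f, hf, h1, h2⟩
    obtain ⟨e, he, -⟩ := hf.exists_equiv_of_image h1 h2
    exact ⟨e, he⟩

theorem Conj.symm (h : F.Conj P Q) : F.Conj Q P := by
  obtain ⟨e, he⟩ := h
  exact ⟨e.symm, he.2, he.1⟩

theorem Conj.trans (h : F.Conj P Q) (h' : F.Conj Q R) : F.Conj P R := by
  obtain ⟨e, he⟩ := h
  obtain ⟨e', he'⟩ := h'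
  exact ⟨e.trans e', F.comp_mem he.1 he'.1, F.comp_mem he'.2 he.2⟩

theorem autConj_le_aut : autConj P ≤ F.Aut P := by
  rintro _ ⟨g, rfl⟩
  refine ⟨F.conj_mem _ g fun x => rfl, F.conj_mem _ (g : S)⁻¹ fun x => ?_⟩
  obtain ⟨y, rfl⟩ := (P.normalizerMonoidHom g).surjective x
  simp [mul_assoc]

theorem isPGroup_autConj (F : FusionSystem p S) (P : Subgroup S) : IsPGroup p (autConj P) :=
  (F.isPGroup.to_subgroup _).of_surjective _ (MonoidHom.rangeRestrict_surjective _)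

end FusionSystem

theorem IsSylowIn.map_subgroupOf {G M : Type u} [Group G] [Group M] [Finite G] {p : ℕ}
    [Fact p.Prime] {H K : Subgroup G} (h : IsSylowIn p H K) (θ : K →* M) :
    IsSylowIn p ((H.subgroupOf K).map θ) θ.range := by
  obtain ⟨hHK, T, hT⟩ := h
  refine ⟨map_le_range _ _, T.mapSurjective θ.rangeRestrict_surjective, ?_⟩
  rw [Sylow.coe_mapSurjective, hT]
  ext ⟨x, hx⟩
  simp [mem_subgroupOf, mem_map, Subtype.ext_iff]

theorem card_le_of_conj_mem {G : Type*} [Group G] [Finite G] {A B : Subgroup G} (g : G)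
    (h : ∀ a ∈ A, g * a * g⁻¹ ∈ B) : Nat.card A ≤ Nat.card B :=
  Nat.card_le_card_of_injective (fun a : A => (⟨g * a * g⁻¹, h a a.2⟩ : B)) fun x y hxy =>
    Subtype.ext (by simpa using congrArg Subtype.val hxy)

/-! ### Saturation of the fusion system of a finite group -/

section GroupFusion

variable {G : Type u} [Group G] {p : ℕ} {S : Sylow p G} {P Q : Subgroup S.toSubgroup}

theorem coe_mem_map_subtype {K : Subgroup G} {A : Subgroup K} {x : K} :
    (x : G) ∈ A.map K.subtype ↔ x ∈ A :=
  ⟨fun ⟨_, hy, h⟩ => Subtype.ext h ▸ hy, fun h => ⟨x, h, rfl⟩⟩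

theorem card_map_subtype {K : Subgroup G} {A : Subgroup K} :
    Nat.card (A.map K.subtype) = Nat.card A := card_map_of_injective K.subtype_injective

theorem mem_centralizer_map_iff {A : Subgroup S.toSubgroup} {g : G} :
    g ∈ centralizer (A.map S.toSubgroup.subtype : Set G) ↔ ∀ x ∈ A, (x : G) * g = g * x :=
  ⟨fun h x hx => h x ⟨x, hx, rfl⟩, by rintro h _ ⟨x, hx, rfl⟩; exact h x hx⟩

theorem centralizer_map_le :
    (centralizer (P : Set S.toSubgroup)).map S.toSubgroup.subtype ≤
      centralizer (P.map S.toSubgroup.subtype : Set G) := by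
  rintro _ ⟨y, hy, rfl⟩
  exact mem_centralizer_map_iff.2 fun x hx => congrArg Subtype.val (hy x hx)

theorem isPGroup_map (A : Subgroup S.toSubgroup) : IsPGroup p (A.map S.toSubgroup.subtype) :=
  (S.isPGroup'.to_subgroup A).map _

theorem groupFusion_mor_iff {f : S.toSubgroup → S.toSubgroup} :
    (groupFusion S).Mor P f ↔ ∃ g : G, ∀ x ∈ P, (f x : G) = g * x * g⁻¹ := by
  constructor
  · rintro ⟨φ, ⟨g, -, hg⟩, h⟩
    exact ⟨g, fun x hx => by rw [h ⟨x, hx⟩]; exact hg ⟨x, hx⟩⟩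
  · rintro ⟨g, hg⟩
    have h : ∀ x : P, ((MulAut.conj g).toMonoidHom.comp
        (S.toSubgroup.subtype.comp P.subtype)) x ∈ S.toSubgroup := fun x => by
      have := (f x).2
      rwa [hg x x.2] at this
    exact ⟨(((MulAut.conj g).toMonoidHom.comp
        (S.toSubgroup.subtype.comp P.subtype)).codRestrict S.toSubgroup h).codRestrict ⊤
        (fun _ => trivial), ⟨g, trivial, fun x => rfl⟩, fun x => Subtype.ext (hg x x.2)⟩

theorem exists_groupFusion_mor {g : G} (h : ∀ x ∈ P, g * x * g⁻¹ ∈ S.toSubgroup) :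
    ∃ f, (groupFusion S).Mor P f ∧ ∀ x ∈ P, (f x : G) = g * x * g⁻¹ := by
  classical
  refine ⟨fun x => if hx : x ∈ P then ⟨_, h x hx⟩ else 1, ?_, ?_⟩
  · exact groupFusion_mor_iff.2 ⟨g, fun x hx => by simp [hx]⟩
  · exact fun x hx => by simp [hx]

theorem mem_groupFusion_aut_iff {α : MulAut P} :
    α ∈ (groupFusion S).Aut P ↔ ∃ g : G, ∀ x : P, ((α x : S.toSubgroup) : G) = g * x * g⁻¹ := by
  constructor
  · rintro ⟨⟨g, -, hg⟩, -⟩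
    exact ⟨g, hg⟩
  · rintro ⟨g, hg⟩
    refine ⟨⟨g, trivial, hg⟩, g⁻¹, trivial, fun y => ?_⟩
    obtain ⟨x, rfl⟩ := α.surjective y
    change (((α.symm (α x) : P) : S.toSubgroup) : G) = _ * ((α x : S.toSubgroup) : G) * _
    rw [hg, MulEquiv.symm_apply_apply]
    group

variable [Finite G] [Fact p.Prime]

theorem exists_conj_mem_sylow (S : Sylow p G) {D : Subgroup G} (hD : IsPGroup p D) :
    ∃ g : G, ∀ d ∈ D, g * d * g⁻¹ ∈ S.toSubgroup := by
  have h : IsSylowIn p S.toSubgroup ⊤ := isSylowIn_iff.2 ⟨le_top, S.isPGroup', fun D _ hD h =>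
    (S.is_maximal' hD h).le⟩
  obtain ⟨g, -, hg⟩ := h.exists_conj_mem le_top hD
  exact ⟨g, hg⟩

/-- A Sylow subgroup `D ≥ N_S(P)` of `N_G(P)` is conjugate into `S` by some `g`. Then `g D g⁻¹ ≤
N_S(g P g⁻¹)`, and full normalization bounds `|D|` by `|N_S(P)|`. -/
theorem isSylowIn_normalizer (h : (groupFusion S).FullyNormalized P) :
    IsSylowIn p ((normalizer (P : Set S.toSubgroup)).map S.toSubgroup.subtype)
      (normalizer (P.map S.toSubgroup.subtype : Set G)) := by
  obtain ⟨D, hD, hDs⟩ := exists_isSylowIn_ge (isPGroup_map (normalizer (P : Set S.toSubgroup)))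
    (K := normalizer (P.map S.toSubgroup.subtype : Set G)) (by
      rintro _ ⟨y, hy, rfl⟩
      refine mem_normalizer_fintype ?_
      rintro _ ⟨x, hx, rfl⟩
      exact ⟨y * x * y⁻¹, (mem_normalizer_iff.1 hy x).1 hx, rfl⟩)
  convert hDs
  obtain ⟨hDN, hDp, -⟩ := isSylowIn_iff.1 hDs
  refine eq_of_le_of_card_ge hD ?_
  obtain ⟨g, hg⟩ := exists_conj_mem_sylow S hDp
  obtain ⟨f, hf, hfg⟩ := exists_groupFusion_mor (S := S) (P := P) (g := g)
    fun x hx => hg x (hD ⟨x, le_normalizer hx, rfl⟩)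
  obtain ⟨P', h1, h2⟩ := hf.exists_image
  rw [card_map_subtype]
  refine le_trans ?_ (h P' (FusionSystem.conj_iff.2 ⟨f, hf, h1, h2⟩))
  rw [← card_map_subtype]
  refine card_le_of_conj_mem g fun d hd => ⟨⟨g * d * g⁻¹, hg d hd⟩, ?_, rfl⟩
  refine mem_normalizer_fintype fun y hy => ?_
  obtain ⟨x, hx, rfl⟩ := h2 y hy
  obtain ⟨x', hx', hxx⟩ := (mem_normalizer_iff.1 (hDN hd) x).1 ⟨x, hx, rfl⟩
  have h3 : (⟨g * d * g⁻¹, hg d hd⟩ * f x * ⟨g * d * g⁻¹, hg d hd⟩⁻¹ : S.toSubgroup) = f x' := by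
    refine Subtype.ext ?_
    rw [hfg x' hx', show (x' : G) = d * x * (d : G)⁻¹ from hxx]
    simp only [Subgroup.coe_mul, Subgroup.coe_inv, hfg x hx]
    group
  rw [h3]
  exact h1 x' hx'

/-- A `p`-subgroup of `C_G(P)` is moved into `N_S(P)` by some `k ∈ N_G(P)`; as `k` normalizes
`C_G(P)`, it lands in `C_S(P)`. -/
theorem isSylowIn_centralizer_of_normalizer
    (h : IsSylowIn p ((normalizer (P : Set S.toSubgroup)).map S.toSubgroup.subtype)
      (normalizer (P.map S.toSubgroup.subtype : Set G))) :
    IsSylowIn p ((centralizer (P : Set S.toSubgroup)).map S.toSubgroup.subtype)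
      (centralizer (P.map S.toSubgroup.subtype : Set G)) := by
  refine isSylowIn_iff.2 ⟨centralizer_map_le, isPGroup_map _, fun D hD hDp hle => ?_⟩
  obtain ⟨k, hk, hkD⟩ := h.exists_conj_mem (hD.trans (centralizer_le_normalizer _)) hDp
  refine (eq_of_le_of_card_ge hle ?_).ge
  refine card_le_of_conj_mem k fun d hd => ?_
  obtain ⟨y, -, hy⟩ := hkD d hd
  refine ⟨y, mem_centralizer_iff.2 fun x hx => Subtype.ext ?_, hy⟩
  obtain ⟨x', hx', hxx⟩ := (mem_normalizer_iff''.1 hk x).1 ⟨x, hx, rfl⟩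
  have h1 := mem_centralizer_map_iff.1 (hD hd) x' hx'
  have h2 : (x : G) = k * x' * k⁻¹ := by
    rw [show (x' : G) = _ from hxx]; simp [mul_assoc]
  rw [Subgroup.coe_mul, Subgroup.coe_mul, show (y : G) = _ from hy, h2]
  calc k * x' * k⁻¹ * (k * d * k⁻¹) = k * (x' * d) * k⁻¹ := by group
    _ = _ := by rw [h1]; group

/-- If `g` conjugates `P` to `P'`, then `g⁻¹` brings `C_S(P')` into `C_G(P)`, where Sylow's theorem
bounds its order by `|C_S(P)|`. -/
theorem fullyCentralized_of_isSylowIn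
    (h : IsSylowIn p ((centralizer (P : Set S.toSubgroup)).map S.toSubgroup.subtype)
      (centralizer (P.map S.toSubgroup.subtype : Set G))) :
    (groupFusion S).FullyCentralized P := by
  intro P' hP'
  obtain ⟨f, hf, h1, h2⟩ := FusionSystem.conj_iff.1 hP'
  obtain ⟨g, hg⟩ := groupFusion_mor_iff.1 hf
  have hD : ((centralizer (P' : Set S.toSubgroup)).map S.toSubgroup.subtype).map
      (MulAut.conj g⁻¹).toMonoidHom ≤ centralizer (P.map S.toSubgroup.subtype : Set G) := by
    rintro _ ⟨_, ⟨y, hy, rfl⟩, rfl⟩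
    refine mem_centralizer_map_iff.2 fun x hx => ?_
    have h3 := congrArg Subtype.val (mem_centralizer_iff.1 hy (f x) (h1 x hx))
    rw [Subgroup.coe_mul, Subgroup.coe_mul, hg x hx] at h3
    simp only [MulEquiv.toMonoidHom_eq_coe, MonoidHom.coe_coe, MulAut.conj_apply, inv_inv,
      subtype_apply]
    calc (x : G) * (g⁻¹ * y * g) = g⁻¹ * (g * x * g⁻¹ * y) * g := by group
      _ = _ := by rw [h3]; group
  obtain ⟨k, -, hk⟩ := h.exists_conj_mem hD ((isPGroup_map _).map _)
  rw [← card_map_subtype, ← card_map_subtype (A := centralizer (P : Set S.toSubgroup))]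
  refine card_le_of_conj_mem (k * g⁻¹) fun d hd => ?_
  convert hk _ ⟨d, hd, rfl⟩ using 1
  simp [mul_assoc]

theorem isSylowIn_centralizer (h : (groupFusion S).FullyCentralized P) :
    IsSylowIn p ((centralizer (P : Set S.toSubgroup)).map S.toSubgroup.subtype)
      (centralizer (P.map S.toSubgroup.subtype : Set G)) := by
  obtain ⟨D, hD, hDs⟩ := exists_isSylowIn_ge (isPGroup_map (centralizer (P : Set S.toSubgroup)))
    centralizer_map_le
  convert hDs
  obtain ⟨hDN, hDp, -⟩ := isSylowIn_iff.1 hDs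
  refine eq_of_le_of_card_ge hD ?_
  -- `D` need not contain `P`, so the `p`-group `D P` is conjugated into `S`; this makes `g P g⁻¹` a
  -- subgroup of `S` as well.
  obtain ⟨g, hg⟩ := exists_conj_mem_sylow S (hDp.to_sup_of_normal_right' (isPGroup_map P)
    (hDN.trans (centralizer_le_normalizer _)))
  obtain ⟨f, hf, hfg⟩ := exists_groupFusion_mor (S := S) (P := P) (g := g)
    fun x hx => hg x (mem_sup_right ⟨x, hx, rfl⟩)
  obtain ⟨P', h1, h2⟩ := hf.exists_image
  rw [card_map_subtype]
  refine le_trans ?_ (h P' (FusionSystem.conj_iff.2 ⟨f, hf, h1, h2⟩))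
  rw [← card_map_subtype]
  refine card_le_of_conj_mem g fun d hd => ⟨⟨g * d * g⁻¹, hg d (mem_sup_left hd)⟩, ?_, rfl⟩
  refine mem_centralizer_iff.2 fun y hy => ?_
  obtain ⟨x, hx, rfl⟩ := h2 y hy
  have h3 := mem_centralizer_map_iff.1 (hDN hd) x hx
  refine Subtype.ext ?_
  rw [Subgroup.coe_mul, Subgroup.coe_mul, hfg x hx]
  calc g * x * g⁻¹ * (g * d * g⁻¹) = g * (x * d) * g⁻¹ := by group
    _ = _ := by rw [h3]; group

/-- `Aut_G(P)` and `Aut_S(P)` are the images of `N_G(P)` and `N_S(P)` under the conjugation action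
`θ`, and a surjection sends Sylow subgroups to Sylow subgroups. -/
theorem isSylowIn_autConj (h : IsSylowIn p
    ((normalizer (P : Set S.toSubgroup)).map S.toSubgroup.subtype)
      (normalizer (P.map S.toSubgroup.subtype : Set G))) :
    IsSylowIn p (autConj P) ((groupFusion S).Aut P) := by
  let ε := P.equivMapOfInjective S.toSubgroup.subtype S.toSubgroup.subtype_injective
  let θ : normalizer (P.map S.toSubgroup.subtype : Set G) →* MulAut P :=
    (MulAut.congr ε.symm).toMonoidHom.comp (normalizerMonoidHom _)
  have hε : ∀ x : P, ((ε x : P.map S.toSubgroup.subtype) : G) = x := fun x => rfl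
  have hθ : ∀ g (x : P), (((θ g x : P) : S.toSubgroup) : G) = g * x * (g : G)⁻¹ := by
    intro g x
    rw [← hε (θ g x), ← hε x, ← normalizerMonoidHom_apply_apply_coe]
    congr 1
    exact ε.apply_symm_apply _
  have key := h.map_subgroupOf θ
  convert key using 1
  · ext α
    rw [mem_autConj]
    constructor
    · rintro ⟨s, hs, H⟩
      refine ⟨⟨s, h.1 ⟨s, hs, rfl⟩⟩, ⟨s, hs, rfl⟩, ?_⟩
      ext x
      rw [hθ, H]
      rfl
    · rintro ⟨g, ⟨s, hs, hsg⟩, rfl⟩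
      refine ⟨s, hs, fun x => Subtype.ext ?_⟩
      rw [hθ, ← show (s : G) = g from hsg]
      rfl
  · ext α
    rw [mem_groupFusion_aut_iff]
    constructor
    · rintro ⟨g, hg⟩
      refine ⟨⟨g, mem_normalizer_fintype ?_⟩, ?_⟩
      · rintro _ ⟨x, hx, rfl⟩
        exact ⟨α ⟨x, hx⟩, (α _).2, hg ⟨x, hx⟩⟩
      · ext x
        rw [hθ, hg]
    · rintro ⟨g, rfl⟩
      exact ⟨g, hθ g⟩

/-- Let `L` be the group of elements of `G` acting on `R` as elements of `N_S(R)`, so `L = C_G(R)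
N_S(R)`. Since `C_S(R)` is Sylow in `C_G(R)`, `N_S(R)` is Sylow in `L`. The definition of `N_e` says
exactly that `g N_e g⁻¹ ≤ L`. -/
theorem groupFusion_extend {R : Subgroup S.toSubgroup} {e : P ≃* R} {g : G}
    (hg : ∀ x : P, ((e x : S.toSubgroup) : G) = g * x * g⁻¹)
    (hR : (groupFusion S).FullyCentralized R) :
    ∃ f, (groupFusion S).Mor (extensionSubgroup e) f ∧ ∀ x : P, f x = e x := by
  let L : Subgroup G :=
    { carrier := {l | ∃ h ∈ normalizer (R : Set S.toSubgroup),
        ∀ x ∈ R, l * x * l⁻¹ = ((h * x * h⁻¹ : S.toSubgroup) : G)}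
      one_mem' := ⟨1, one_mem _, by simp⟩
      mul_mem' := by
        rintro l l' ⟨h, hh, hl⟩ ⟨h', hh', hl'⟩
        refine ⟨h * h', mul_mem hh hh', fun x hx => ?_⟩
        have h1 := hl _ ((mem_normalizer_iff.1 hh' x).1 hx)
        rw [← hl' x hx] at h1
        convert h1 using 1
        · group
        · congr 1
          group
      inv_mem' := by
        rintro l ⟨h, hh, hl⟩
        refine ⟨h⁻¹, inv_mem hh, fun x hx => ?_⟩
        have h1 := hl _ ((mem_normalizer_iff''.1 hh x).1 hx)
        simp only [mul_assoc, mul_inv_cancel, mul_inv_cancel_left, mul_one] at h1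
        simp only [mul_assoc, ← h1, inv_inv, inv_mul_cancel_left, inv_mul_cancel, mul_one] }
  have hHL : (normalizer (R : Set S.toSubgroup)).map S.toSubgroup.subtype ≤ L := by
    rintro _ ⟨h, hh, rfl⟩
    exact ⟨h, hh, fun x hx => rfl⟩
  have hinf : (normalizer (R : Set S.toSubgroup)).map S.toSubgroup.subtype ⊓
      centralizer (R.map S.toSubgroup.subtype : Set G) =
      (centralizer (R : Set S.toSubgroup)).map S.toSubgroup.subtype := by
    refine le_antisymm ?_ (le_inf (map_mono (centralizer_le_normalizer _)) centralizer_map_le)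
    rintro _ ⟨⟨y, -, rfl⟩, hy⟩
    exact ⟨y, mem_centralizer_iff.2 fun x hx => Subtype.ext (mem_centralizer_map_iff.1 hy x hx),
      rfl⟩
  have hs : IsSylowIn p ((normalizer (R : Set S.toSubgroup)).map S.toSubgroup.subtype) L := by
    refine isSylowIn_of_inter (K := centralizer (R.map S.toSubgroup.subtype : Set G)) hHL
      (isPGroup_map _) (by rw [hinf]; exact isSylowIn_centralizer hR) ?_
    rintro l ⟨h, hh, hl⟩
    refine ⟨h, ⟨h, hh, rfl⟩, mem_centralizer_map_iff.2 fun x hx => ?_⟩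
    have h1 := hl _ ((mem_normalizer_iff''.1 hh x).1 hx)
    simp only [Subgroup.coe_mul, Subgroup.coe_inv, mul_assoc, mul_inv_cancel,
      mul_inv_cancel_left, mul_one] at h1
    nth_rewrite 1 [← h1]
    simp [mul_assoc]
  have hD : ((extensionSubgroup e).map S.toSubgroup.subtype).map
      (MulAut.conj g).toMonoidHom ≤ L := by
    rintro _ ⟨_, ⟨y, hy, rfl⟩, rfl⟩
    obtain ⟨hyP, h, hh, hyh⟩ := mem_extensionSubgroup.1 hy
    refine ⟨h, hh, fun x hx => ?_⟩
    obtain ⟨x', hx'⟩ := e.surjective ⟨x, hx⟩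
    have h1 := congrArg Subtype.val (hyh x' ⟨_, (mem_normalizer_iff.1 hyP x').1 x'.2⟩ rfl)
    have h2 := hg x'
    rw [hx'] at h1 h2
    rw [← h1, hg]
    simp only [MulEquiv.toMonoidHom_eq_coe, MonoidHom.coe_coe, MulAut.conj_apply,
      subtype_apply, Subgroup.coe_mul, Subgroup.coe_inv, show (x : G) = _ from h2]
    group
  -- `k` moves `g N_e g⁻¹` into `N_S(R)` but may act on `R`, there as some `h ∈ N_S(R)`. Hence `h⁻¹
  -- k g` still sends `N_e` into `S` and agrees with `g` on `P`.
  obtain ⟨k, ⟨h, hh, hkh⟩, hk⟩ := hs.exists_conj_mem hD ((isPGroup_map _).map _)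
  have hmem : ∀ y ∈ extensionSubgroup e,
      ((h : G)⁻¹ * k * g) * y * ((h : G)⁻¹ * k * g)⁻¹ ∈ S.toSubgroup := by
    intro y hy
    obtain ⟨z, -, hz⟩ := hk _ ⟨_, ⟨y, hy, rfl⟩, rfl⟩
    convert (h⁻¹ * z * h).2 using 1
    rw [Subgroup.coe_mul, Subgroup.coe_mul, show (z : G) = _ from hz]
    simp [mul_assoc]
  obtain ⟨f, hf, hfg⟩ := exists_groupFusion_mor hmem
  refine ⟨f, hf, fun x => Subtype.ext ?_⟩
  have hx : (x : S.toSubgroup) ∈ extensionSubgroup e := le_extensionSubgroup x.2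
  have h1 := hkh _ (e x).2
  rw [hg] at h1
  rw [hfg _ hx]
  calc _ = (h : G)⁻¹ * (k * (g * x * g⁻¹) * k⁻¹) * h := by group
    _ = _ := by
      rw [h1]
      simp [mul_assoc, hg]

theorem groupFusion_isSaturated (S : Sylow p G) : (groupFusion S).IsSaturated where
  sylow P hP := ⟨fullyCentralized_of_isSylowIn
    (isSylowIn_centralizer_of_normalizer (isSylowIn_normalizer hP)),
    isSylowIn_autConj (isSylowIn_normalizer hP)⟩
  extend P R φ e hφ he hR := by
    obtain ⟨g, -, hg⟩ := hφ
    obtain ⟨f, ⟨φ', hφ', hf⟩, hfe⟩ := groupFusion_extend (e := e) (g := g)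
      (fun x => by rw [he]; exact hg x) hR
    refine ⟨φ', hφ', fun x hx hx' => Subtype.ext ?_⟩
    rw [← hf ⟨x, hx'⟩, ← he]
    exact hfe ⟨x, hx⟩

end GroupFusion

/-! ### Lifting saturation from the normalizer of a central subgroup of order `p` -/

/-- The number of fixed points of `T` is congruent to `|P|`, hence to `0`, modulo `p`. They form a
subgroup, so Cauchy's theorem applies. -/
theorem exists_fixed_of_isPGroup {S : Type u} [Group S] [Finite S] {p : ℕ} [Fact p.Prime]
    (hS : IsPGroup p S) {P : Subgroup S} (hP : P ≠ ⊥) {T : Subgroup (MulAut P)}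
    (hT : IsPGroup p T) : ∃ a : P, a ≠ 1 ∧ a ^ p = 1 ∧ ∀ t ∈ T, t a = a := by
  have : Nontrivial P := (nontrivial_iff_ne_bot P).2 hP
  obtain ⟨n, hn, hc⟩ := (hS.to_subgroup P).nontrivial_iff_card.1 this
  have h1 := hT.card_modEq_card_fixedPoints P
  have h2 : p ∣ Nat.card (FixedPoints.subgroup T P) :=
    (Nat.modEq_zero_iff_dvd.1 (h1.symm.trans (Nat.modEq_zero_iff_dvd.2
      (hc ▸ dvd_pow_self p hn.ne'))))
  obtain ⟨x, hx⟩ := exists_prime_orderOf_dvd_card' p h2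
  refine ⟨x, ?_, ?_, fun t ht => x.2 ⟨t, ht⟩⟩
  · intro h
    have : x = 1 := Subtype.ext h
    rw [this, orderOf_one] at hx
    exact (Fact.out : p.Prime).one_lt.ne hx
  · have := pow_orderOf_eq_one x
    rw [hx] at this
    exact congrArg Subtype.val this

theorem le_of_mem_of_card_prime {S : Type u} [Group S] {p : ℕ} [Fact p.Prime] {Z P : Subgroup S}
    (hZ : Nat.card Z = p) {z : S} (hz : z ∈ Z) (hz1 : z ≠ 1) (hzP : z ∈ P) : Z ≤ P := by
  intro w hw
  obtain ⟨n, hn⟩ := mem_powers_of_prime_card (g := (⟨z, hz⟩ : Z)) (g' := ⟨w, hw⟩) hZ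
    (fun h => hz1 (congrArg Subtype.val h))
  have : z ^ n = w := congrArg Subtype.val hn
  exact this ▸ pow_mem hzP n

theorem exists_ne_one_of_card_prime {S : Type u} [Group S] {p : ℕ} [hp : Fact p.Prime]
    {Z : Subgroup S} (hZ : Nat.card Z = p) : ∃ z ∈ Z, z ≠ 1 ∧ z ^ p = 1 := by
  have : Finite Z := Nat.finite_of_card_ne_zero (hZ ▸ hp.out.ne_zero)
  have : Nontrivial Z := Finite.one_lt_card_iff_nontrivial.1 (hZ ▸ hp.out.one_lt)
  obtain ⟨z, hz⟩ := exists_ne (1 : Z)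
  refine ⟨z, z.2, fun h => hz (Subtype.ext h), ?_⟩
  have := pow_card_eq_one' (x := z)
  rw [hZ] at this
  exact congrArg Subtype.val this

namespace FusionSystem

variable {p : ℕ} {S : Type u} [Group S] {F F₀ : FusionSystem p S} {P Q : Subgroup S}

theorem Mor.mapsTo_of_card_prime [Fact p.Prime] {f : S → S} {Z : Subgroup S} (hf : F.Mor P f)
    (hZ : Nat.card Z = p) (hZP : Z ≤ P) {z : S} (hz : z ∈ Z) (hz1 : z ≠ 1) (hfz : f z ∈ Z) :
    ∀ w ∈ Z, f w ∈ Z := by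
  intro w hw
  obtain ⟨n, hn⟩ := mem_powers_of_prime_card (g := (⟨z, hz⟩ : Z)) (g' := ⟨w, hw⟩) hZ
    (fun h => hz1 (congrArg Subtype.val h))
  have : z ^ n = w := congrArg Subtype.val hn
  rw [← this, hf.map_pow (hZP hz)]
  exact pow_mem hfz n

theorem Mor.ne_one {f : S → S} (hf : F.Mor P f) {x : S} (hx : x ∈ P) (h : x ≠ 1) : f x ≠ 1 :=
  fun h' => h (hf.injOn hx P.one_mem (h'.trans hf.map_one.symm))

theorem Mor.mem_normalizer [Finite S] {f : S → S} {N : Subgroup S} (hf : F.Mor N f) (hPN : P ≤ N)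
    (h1 : ∀ x ∈ P, f x ∈ Q) (h2 : ∀ y ∈ Q, ∃ x ∈ P, f x = y) {g : S}
    (hg : g ∈ normalizer (P : Set S)) (hgN : g ∈ N) : f g ∈ normalizer (Q : Set S) := by
  refine mem_normalizer_fintype fun y hy => ?_
  obtain ⟨x, hx, rfl⟩ := h2 y hy
  rw [← hf.map_conj hgN (hPN hx)]
  exact h1 _ ((mem_normalizer_iff.1 hg x).1 hx)

theorem Mor.mem_centralizer_iff {f : S → S} {N : Subgroup S} (hf : F.Mor N f) (hPN : P ≤ N)
    (h1 : ∀ x ∈ P, f x ∈ Q) (h2 : ∀ y ∈ Q, ∃ x ∈ P, f x = y) {g : S} (hgN : g ∈ N) :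
    f g ∈ centralizer (Q : Set S) ↔ g ∈ centralizer (P : Set S) := by
  constructor
  · refine fun hg x hx => hf.injOn (mul_mem (hPN hx) hgN) (mul_mem hgN (hPN hx)) ?_
    rw [hf.map_mul (hPN hx) hgN, hf.map_mul hgN (hPN hx)]
    exact hg _ (h1 x hx)
  · intro hg y hy
    obtain ⟨x, hx, rfl⟩ := h2 y hy
    rw [← hf.map_mul (hPN hx) hgN, ← hf.map_mul hgN (hPN hx), hg x hx]

theorem Conj.mono (hle : ∀ P Q, F₀.Hom P Q ⊆ F.Hom P Q) (h : F₀.Conj P Q) : F.Conj P Q := by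
  obtain ⟨e, he⟩ := h
  exact ⟨e, hle _ _ he.1, hle _ _ he.2⟩

theorem Mor.of_le (hle : ∀ P Q, F₀.Hom P Q ⊆ F.Hom P Q) {f : S → S} (h : F₀.Mor P f) :
    F.Mor P f := by
  obtain ⟨φ, hφ, h⟩ := h
  exact ⟨φ, hle _ _ hφ, h⟩

theorem Conj.eq_bot (h : F.Conj ⊥ Q) : Q = ⊥ := by
  obtain ⟨f, hf, -, h2⟩ := conj_iff.1 h
  refine (eq_bot_iff_forall Q).2 fun y hy => ?_
  obtain ⟨x, hx, rfl⟩ := h2 y hy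
  rw [mem_bot.1 hx, hf.map_one]

/-- `F₀` is the normalizer in `F` of the central subgroup `Z` of order `p`, and each element of
order `p` can be moved into `Z` by a morphism of `F` that is defined on its centralizer. -/
structure IsCentralReduction (F F₀ : FusionSystem p S) (Z : Subgroup S) : Prop where
  le : ∀ P Q, F₀.Hom P Q ⊆ F.Hom P Q
  le_center : Z ≤ center S
  card_eq : Nat.card Z = p
  mor : ∀ P, Z ≤ P → ∀ f, F.Mor P f → (∀ z ∈ Z, f z ∈ Z) → F₀.Mor P f
  transport : ∀ a, a ≠ 1 → a ^ p = 1 → ∃ ψ, F.Mor (centralizer {a}) ψ ∧ ψ a ∈ Z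

namespace IsCentralReduction

variable {Z : Subgroup S} [Fact p.Prime] (H : IsCentralReduction F F₀ Z)
include H

theorem isIso {e : P ≃* Q} (he : F.IsIso e) {z : P} (hz : (z : S) ∈ Z) (hz1 : z ≠ 1)
    (hez : (e z : S) ∈ Z) : F₀.IsIso e := by
  obtain ⟨f, hf, h⟩ := exists_mor he.1
  have hz1' : (z : S) ≠ 1 := fun h => hz1 (Subtype.ext h)
  have hZP : Z ≤ P := le_of_mem_of_card_prime H.card_eq hz hz1' z.2
  refine (H.mor P hZP f hf (hf.mapsTo_of_card_prime H.card_eq hZP hz hz1' ?_)).isIso h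
  rw [h]
  exact hez

variable [Finite S]

/-- If `f : P → P'` is an `F`-isomorphism and `1 ≠ z ∈ Z`, then `f z` is central in `P'`, so the
morphism `ψ` moving `f z` into `Z` is defined on `P'` and on `C_S(P')`. Now `ψ ∘ f` preserves `Z`,
so `ψ(P')` is `F₀`-conjugate to `P`, and `ψ` embeds `C_S(P')` into `C_S(ψ(P'))`. -/
theorem fullyCentralized (hZP : Z ≤ P) (hP : F₀.FullyCentralized P) : F.FullyCentralized P := by
  intro P' hP'
  obtain ⟨f, hf, h1, h2⟩ := conj_iff.1 hP'
  obtain ⟨z, hz, hz1, hzp⟩ := exists_ne_one_of_card_prime H.card_eq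
  obtain ⟨ψ, hψ, hψz⟩ := H.transport (f z) (hf.ne_one (hZP hz) hz1)
    (by rw [← hf.map_pow (hZP hz), hzp, hf.map_one])
  have hP'c : P' ≤ centralizer {f z} := by
    intro y hy
    obtain ⟨x, hx, rfl⟩ := h2 y hy
    rw [mem_centralizer_singleton_iff, ← hf.map_mul hx (hZP hz), ← hf.map_mul (hZP hz) hx,
      mem_center_iff.1 (H.le_center hz) x]
  have hCc : centralizer (P' : Set S) ≤ centralizer {f z} :=
    centralizer_le (Set.singleton_subset_iff.2 (h1 z (hZP hz)))
  obtain ⟨P'', k1, k2⟩ := (hψ.mono hP'c).exists_image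
  have hcomp := (hψ.mono hP'c).comp hf h1
  have h₀ := H.mor P hZP _ hcomp (hcomp.mapsTo_of_card_prime H.card_eq hZP hz hz1 hψz)
  have hconj : F₀.Conj P P'' := conj_iff.2 ⟨_, h₀, fun x hx => k1 _ (h1 x hx), fun y hy => by
    obtain ⟨x, hx, rfl⟩ := k2 y hy
    obtain ⟨w, hw, rfl⟩ := h2 x hx
    exact ⟨w, hw, rfl⟩⟩
  exact (hψ.card_le hCc fun g hg => (hψ.mem_centralizer_iff hP'c k1 k2 (hCc hg)).2 hg).trans
    (hP P'' hconj)

/-- Let `a` be fixed by a Sylow subgroup `T ≥ Aut_S(P)` of `Aut_F(P)`, and let `ψ` move `a` into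
`Z`. Then `P' = ψ(P)` contains `Z` and is fully normalized in `F₀`, and both conclusions are pulled
back from `P'` along `ψ`. -/
theorem sylow_of_ne_bot (h₀ : F₀.IsSaturated) (hP : F.FullyNormalized P) (hbot : P ≠ ⊥) :
    F.FullyCentralized P ∧ IsSylowIn p (autConj P) (F.Aut P) := by
  obtain ⟨T, hT, hTs⟩ := exists_isSylowIn_ge (isPGroup_autConj F P) autConj_le_aut
  obtain ⟨hTF, hTp, -⟩ := isSylowIn_iff.1 hTs
  obtain ⟨a, ha1, hap, hTa⟩ := exists_fixed_of_isPGroup F.isPGroup hbot hTp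
  have ha1' : (a : S) ≠ 1 := fun h => ha1 (Subtype.ext h)
  obtain ⟨ψ, hψ, hψa⟩ := H.transport a ha1' (congrArg Subtype.val hap)
  have hNa : normalizer (P : Set S) ≤ centralizer {(a : S)} := by
    intro g hg
    have := congrArg Subtype.val (hTa _ (hT ⟨⟨g, hg⟩, rfl⟩))
    rw [normalizerMonoidHom_apply_apply_coe] at this
    exact mem_centralizer_singleton_iff.2 (mul_inv_eq_iff_eq_mul.1 this)
  have hPa : P ≤ centralizer {(a : S)} := le_normalizer.trans hNa
  obtain ⟨P', k1, k2⟩ := (hψ.mono hPa).exists_image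
  have hPP' : F.Conj P P' := conj_iff.2 ⟨ψ, hψ.mono hPa, k1, k2⟩
  have hN : ∀ g ∈ normalizer (P : Set S), ψ g ∈ normalizer (P' : Set S) := fun g hg =>
    hψ.mem_normalizer hPa k1 k2 hg (hNa hg)
  -- Full normalization of `P` in `F` makes the embedding `N_S(P) → N_S(P')` surjective, which is
  -- what allows pulling back.
  have hNs := hψ.surjOn hNa hN (hP P' hPP')
  obtain ⟨e, he, heψ⟩ := (hψ.mono hPa).exists_equiv_of_image k1 k2
  have hea : (e a : S) ∈ Z := heψ a ▸ hψa
  have hea1 : e a ≠ 1 := fun h => ha1 (e.injective (h.trans (map_one e).symm))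
  have hZP' : Z ≤ P' := le_of_mem_of_card_prime H.card_eq hea (fun h => hea1 (Subtype.ext h))
    (e a).2
  obtain ⟨hP'c, hP's⟩ := h₀.sylow P' fun P'' hP'' =>
    (hP P'' (hPP'.trans (hP''.mono H.le))).trans (hψ.card_le hNa hN)
  refine ⟨fun P₂ hP₂ => ?_, ?_⟩
  · refine (H.fullyCentralized hZP' hP'c P₂ (hPP'.symm.trans hP₂)).trans ?_
    obtain ⟨f', hf', hf'ψ⟩ := (hψ.mono hNa).exists_inverse hN hNs
    refine hf'.card_le (centralizer_le_normalizer _) fun c hc => ?_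
    obtain ⟨n, hn, rfl⟩ := hNs c (centralizer_le_normalizer _ hc)
    rw [hf'ψ n hn]
    exact (hψ.mem_centralizer_iff hPa k1 k2 (hNa hn)).1 hc
  -- Transported to `P'`, `T` fixes `e a`, a generator of `Z`, so it lies in `Aut_{F₀}(P')`. It
  -- contains the Sylow subgroup `Aut_S(P')`, hence equals it.
  · have hT' : T.map (MulAut.congr e).toMonoidHom ≤ autConj P' := by
      refine (isSylowIn_iff.1 hP's).2.2 _ ?_ (hTp.map _) ?_
      · rintro _ ⟨t, ht, rfl⟩
        refine H.isIso (z := e a) ?_ hea hea1 ?_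
        · exact ⟨F.comp_mem he.2 (F.comp_mem (hTF ht).1 he.1),
            F.comp_mem (F.comp_mem he.2 (hTF ht).2) he.1⟩
        · change ((e (t (e.symm (e a))) : P') : S) ∈ Z
          rwa [e.symm_apply_apply, hTa t ht]
      · intro α hα
        obtain ⟨n', hn', hα⟩ := mem_autConj.1 hα
        obtain ⟨n, hn, rfl⟩ := hNs n' hn'
        refine ⟨_, hT ⟨⟨n, hn⟩, rfl⟩, ?_⟩
        ext x
        obtain ⟨x, rfl⟩ := e.surjective x
        rw [hα, heψ, ← hψ.map_conj (hNa hn) (hPa x.2)]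
        change ((e (P.normalizerMonoidHom ⟨n, hn⟩ (e.symm (e x))) : P') : S) = _
        rw [e.symm_apply_apply, heψ]
        rfl
    have : T = autConj P := by
      refine le_antisymm (fun t ht => ?_) hT
      obtain ⟨n', hn', h⟩ := mem_autConj.1 (hT' ⟨t, ht, rfl⟩)
      obtain ⟨n, hn, rfl⟩ := hNs n' hn'
      refine mem_autConj.2 ⟨n, hn, fun x => ?_⟩
      have hx := h (e x)
      change ((e (t (e.symm (e x))) : P') : S) = _ at hx
      rw [e.symm_apply_apply, heψ, heψ, ← hψ.map_conj (hNa hn) (hPa x.2)] at hx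
      exact hψ.injOn (hPa (t x).2) (hPa ((mem_normalizer_iff.1 hn x).1 x.2)) hx
    rwa [← this]

/-- Choose `a` such that `e a` is fixed by `Aut_S(R)`; then `N_S(R)` centralizes `e a` and `N_e`
centralizes `a`. With `ψ` and `ψ'` moving `a` and `e a` into `Z`, the map `τ = ψ' e ψ⁻¹` lies in
`F₀` and extends there to `N_τ ≥ ψ(N_e)`. The required extension is `ψ'⁻¹ f₀ ψ`, where `f₀` extends
`τ`. -/
theorem extend_of_ne_bot {R : Subgroup S} (h₀ : F₀.IsSaturated) {e : P ≃* R} (he : F.IsIso e)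
    (hR : F.FullyCentralized R) (hbot : R ≠ ⊥) :
    ∃ f, F.Mor (extensionSubgroup e) f ∧ ∀ x : P, f x = e x := by
  obtain ⟨a', ha1', hap', hTa⟩ := exists_fixed_of_isPGroup F.isPGroup hbot (isPGroup_autConj F R)
  obtain ⟨a, rfl⟩ := e.surjective a'
  have ha1 : a ≠ 1 := fun h => ha1' (h ▸ map_one e)
  have hap : a ^ p = 1 := e.injective (by rw [map_pow, hap', map_one])
  have hNR : normalizer (R : Set S) ≤ centralizer {(e a : S)} := by
    intro g hg
    have := congrArg Subtype.val (hTa _ ⟨⟨g, hg⟩, rfl⟩)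
    rw [normalizerMonoidHom_apply_apply_coe] at this
    exact mem_centralizer_singleton_iff.2 (mul_inv_eq_iff_eq_mul.1 this)
  have hNe : extensionSubgroup e ≤ centralizer {(a : S)} := by
    intro g hg
    obtain ⟨hgP, h, hh, H⟩ := mem_extensionSubgroup.1 hg
    have h1 := H a ⟨_, (mem_normalizer_iff.1 hgP a).1 a.2⟩ rfl
    rw [mem_centralizer_singleton_iff.1 (hNR hh), mul_inv_cancel_right] at h1
    have h2 := congrArg Subtype.val (e.injective (Subtype.ext h1))
    exact mem_centralizer_singleton_iff.2 (mul_inv_eq_iff_eq_mul.1 h2)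
  have hPe := le_extensionSubgroup (e := e)
  have hPa := hPe.trans hNe
  have hRa : R ≤ centralizer {(e a : S)} := le_normalizer.trans hNR
  have hCa : centralizer (R : Set S) ≤ centralizer {(e a : S)} :=
    (centralizer_le_normalizer _).trans hNR
  obtain ⟨ψ, hψ, hψa⟩ := H.transport a (fun h => ha1 (Subtype.ext h)) (congrArg Subtype.val hap)
  obtain ⟨ψ', hψ', hψa'⟩ := H.transport (e a) (fun h => ha1' (Subtype.ext h))
    (congrArg Subtype.val hap')
  obtain ⟨Q, k1, k2⟩ := (hψ.mono hPa).exists_image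
  obtain ⟨Q', k1', k2'⟩ := (hψ'.mono hRa).exists_image
  obtain ⟨e1, he1, hψe⟩ := (hψ.mono hPa).exists_equiv_of_image k1 k2
  obtain ⟨e2, he2, hψe'⟩ := (hψ'.mono hRa).exists_equiv_of_image k1' k2'
  let τ : Q ≃* Q' := e1.symm.trans (e.trans e2)
  have hτe : ∀ x, τ (e1 x) = e2 (e x) := fun x =>
    congrArg (fun y => e2 (e y)) (e1.symm_apply_apply x)
  have hτ : F₀.IsIso τ := by
    refine H.isIso (z := e1 a) ⟨F.comp_mem he1.2 (F.comp_mem he.1 he2.1),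
      F.comp_mem (F.comp_mem he2.2 he.2) he1.1⟩ ?_ ?_ ?_
    · rwa [hψe]
    · exact fun h => ha1 (e1.injective (h.trans (map_one e1).symm))
    · rwa [hτe, hψe']
  have hRQ' : F.Conj R Q' := ⟨e2, he2⟩
  have hC : ∀ c ∈ centralizer (R : Set S), ψ' c ∈ centralizer (Q' : Set S) := fun c hc =>
    (hψ'.mem_centralizer_iff hRa k1' k2' (hCa hc)).2 hc
  have hCs := hψ'.surjOn hCa hC (hR Q' hRQ')
  obtain ⟨φ', hφ', hext⟩ := h₀.extend Q Q' ((inclusion le_top).comp τ.toMonoidHom) τ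
    (F₀.comp_mem hτ.1 (inclusion_mem le_top)) (fun x => rfl) fun P'' hP'' =>
      (hR P'' (hRQ'.trans (hP''.mono H.le))).trans (hψ'.card_le hCa hC)
  obtain ⟨f₀, hf₀, hfφ⟩ := exists_mor hφ'
  have hf₀τ : ∀ y : Q, f₀ y = τ y := fun y => by
    rw [hfφ ⟨y, le_extensionSubgroup y.2⟩, hext y y.2]
    rfl
  have hψN : ∀ g ∈ extensionSubgroup e, ∃ h ∈ normalizer (R : Set S),
      ψ g ∈ normalizer (Q : Set S) ∧
      ∀ x y : Q, (y : S) = ψ g * x * (ψ g)⁻¹ → (τ y : S) = ψ' h * τ x * (ψ' h)⁻¹ := by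
    intro g hg
    obtain ⟨hgP, h, hh, H⟩ := mem_extensionSubgroup.1 hg
    refine ⟨h, hh, hψ.mem_normalizer hPa k1 k2 hgP (hNe hg), fun x y hxy => ?_⟩
    obtain ⟨x, rfl⟩ := e1.surjective x
    obtain ⟨y, rfl⟩ := e1.surjective y
    rw [hψe, hψe, ← hψ.map_conj (hNe hg) (hPa x.2)] at hxy
    have := H x y (hψ.injOn (hPa y.2) (hPa ((mem_normalizer_iff.1 hgP x).1 x.2)) hxy)
    rw [hτe, hτe, hψe', hψe', this, hψ'.map_conj (hNR hh) (hRa (e x).2)]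
  have hψext : ∀ g ∈ extensionSubgroup e, ψ g ∈ extensionSubgroup τ := by
    intro g hg
    obtain ⟨h, hh, h1, h2⟩ := hψN g hg
    exact mem_extensionSubgroup.2 ⟨h1, ψ' h, hψ'.mem_normalizer hRa k1' k2' hh (hNR hh), h2⟩
  obtain ⟨M, m1, m2⟩ := hψ'.exists_image
  obtain ⟨f', hf', hf'ψ⟩ := hψ'.exists_inverse m1 m2
  -- `ψ'⁻¹` is applicable: `f₀ (ψ g)` and `ψ' h` act alike on `Q'`, so they differ by an element of
  -- `C_S(Q')`, which is `ψ'(C_S(R))` because `R` is fully centralized.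
  have hM : ∀ g ∈ extensionSubgroup e, f₀ (ψ g) ∈ M := by
    intro g hg
    obtain ⟨h, hh, h1, h2⟩ := hψN g hg
    have hc : (ψ' h)⁻¹ * f₀ (ψ g) ∈ centralizer (Q' : Set S) := by
      intro q hq
      obtain ⟨x, hx⟩ := τ.surjective ⟨q, hq⟩
      have h3 := h2 x ⟨_, (mem_normalizer_iff.1 h1 x).1 x.2⟩ rfl
      rw [← hf₀τ, ← hf₀τ, hf₀.map_conj (hψext g hg) (le_extensionSubgroup x.2), hf₀τ, hx] at h3
      change q * _ = _ * q
      calc q * ((ψ' h)⁻¹ * f₀ (ψ g)) = (ψ' h)⁻¹ * (ψ' h * q * (ψ' h)⁻¹) * f₀ (ψ g) := by group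
        _ = _ := by rw [← h3]; group
    obtain ⟨c, hc, hce⟩ := hCs _ hc
    have : f₀ (ψ g) = ψ' h * ψ' c := by rw [hce]; group
    rw [this]
    exact mul_mem (m1 _ (hNR hh)) (m1 _ (hCa hc))
  refine ⟨_, hf'.comp ((hf₀.of_le H.le).comp (hψ.mono hNe) hψext) hM, fun x => ?_⟩
  simp only [Function.comp_apply]
  rw [← hψe, hf₀τ, hτe, hψe', hf'ψ _ (hRa (e x).2)]

theorem isSaturated (h₀ : F₀.IsSaturated) : F.IsSaturated where
  sylow P hP := by
    -- The trivial subgroup has no element of order `p` to move into `Z`.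
    by_cases hbot : P = ⊥
    · subst hbot
      refine ⟨fun P' hP' => by rw [hP'.eq_bot], isSylowIn_iff.2 ⟨autConj_le_aut,
        isPGroup_autConj F ⊥, fun D _ _ _ α _ => ?_⟩⟩
      rw [show α = 1 from MulEquiv.ext fun x => Subsingleton.elim _ _]
      exact one_mem _
    · exact H.sylow_of_ne_bot h₀ hP hbot
  extend P R φ e hφ heφ hR := by
    obtain ⟨f, hf, hfφ⟩ := exists_mor hφ
    have he : F.IsIso e := hf.isIso fun x => by rw [hfφ, heφ]
    by_cases hbot : R = ⊥
    · subst hbot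
      have hP : P = ⊥ := Conj.eq_bot (F := F) ⟨e.symm, he.2, he.1⟩
      subst hP
      refine ⟨inclusion le_top, inclusion_mem le_top, fun x hx hx' => ?_⟩
      obtain rfl := mem_bot.1 hx
      exact (map_one φ).symm
    · obtain ⟨f', ⟨φ', hφ', h1⟩, h2⟩ := H.extend_of_ne_bot h₀ he hR hbot
      refine ⟨φ', hφ', fun x hx hx' => Subtype.ext ?_⟩
      rw [← h1 ⟨x, hx'⟩, ← heφ]
      exact h2 ⟨x, hx⟩

end IsCentralReduction

end FusionSystem

/-! ### Conjugation in `G` between subgroups of `S` -/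

section Ambient

variable {G : Type u} [Group G] {p : ℕ} {S : Sylow p G}

/-- A subgroup of the Sylow subgroup `S`, regarded as a subgroup of `G`. -/
abbrev ambient (A : Subgroup S.toSubgroup) : Subgroup G := A.map S.toSubgroup.subtype

/-- The function on `G` that agrees with the automorphism `γ` on `S₀`. -/
noncomputable def extendAut {S₀ : Subgroup S.toSubgroup} (γ : MulAut S₀) : G → G :=
  Function.extend (fun y : S₀ => ((y : S.toSubgroup) : G)) (fun y => ((γ y : S.toSubgroup) : G)) 1

theorem extendAut_apply {S₀ : Subgroup S.toSubgroup} (γ : MulAut S₀) (y : S₀) :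
    extendAut γ ((y : S.toSubgroup) : G) = ((γ y : S.toSubgroup) : G) :=
  (Subtype.val_injective.comp Subtype.val_injective).extend_apply _ _ y

theorem AreConj.refl (A : Subgroup S.toSubgroup) : AreConj S.toSubgroup.subtype A A :=
  ⟨1, by rw [map_one]; exact Subgroup.map_id _⟩

theorem AreConj.symm {A B : Subgroup S.toSubgroup} (h : AreConj S.toSubgroup.subtype A B) :
    AreConj S.toSubgroup.subtype B A := by
  obtain ⟨g, hg⟩ := h
  refine ⟨g⁻¹, ?_⟩
  have h1 : (MulAut.conj g⁻¹).toMonoidHom.comp (MulAut.conj g).toMonoidHom = MonoidHom.id G := by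
    ext x
    simp [mul_assoc]
  rw [← hg, map_map, h1, Subgroup.map_id]

theorem AreConj.trans {A B C : Subgroup S.toSubgroup} (h : AreConj S.toSubgroup.subtype A B)
    (h' : AreConj S.toSubgroup.subtype B C) : AreConj S.toSubgroup.subtype A C := by
  obtain ⟨g, hg⟩ := h
  obtain ⟨g', hg'⟩ := h'
  refine ⟨g' * g, ?_⟩
  have h1 : (MulAut.conj g').toMonoidHom.comp (MulAut.conj g).toMonoidHom =
      (MulAut.conj (g' * g)).toMonoidHom := by
    ext x
    simp [mul_assoc]
  rw [← hg', ← hg, map_map _ (MulAut.conj g').toMonoidHom, h1]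

theorem areConj_of_forall {A B : Subgroup S.toSubgroup} {g : G}
    (h1 : ∀ x ∈ A, ∃ y ∈ B, (y : G) = g * x * g⁻¹)
    (h2 : ∀ y ∈ B, ∃ x ∈ A, (y : G) = g * x * g⁻¹) : AreConj S.toSubgroup.subtype A B := by
  refine ⟨g, le_antisymm ?_ ?_⟩
  · rintro _ ⟨_, ⟨x, hx, rfl⟩, rfl⟩
    obtain ⟨y, hy, h⟩ := h1 x hx
    exact ⟨y, hy, h⟩
  · rintro _ ⟨y, hy, rfl⟩
    obtain ⟨x, hx, h⟩ := h2 y hy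
    exact ⟨x, ⟨x, hx, rfl⟩, h.symm⟩

/-- Conjugation into a fully centralized subgroup extends to the centralizer. -/
theorem AreConj.exists_conj_centralizer [Finite G] [Fact p.Prime] {A B : Subgroup S.toSubgroup}
    (h : AreConj S.toSubgroup.subtype A B) (hB : (groupFusion S).FullyCentralized B) :
    ∃ g : G, (∀ x ∈ A, ∃ y ∈ B, (y : G) = g * x * g⁻¹) ∧
      ∀ x ∈ centralizer (A : Set S.toSubgroup), ∃ y ∈ centralizer (B : Set S.toSubgroup),
        (y : G) = g * x * g⁻¹ := by
  obtain ⟨g, hg⟩ := h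
  have hD : (ambient (centralizer (A : Set S.toSubgroup))).map (MulAut.conj g).toMonoidHom ≤
      centralizer (ambient B : Set G) := by
    rintro _ ⟨_, ⟨x, hx, rfl⟩, rfl⟩
    rw [ambient, ← hg]
    rintro _ ⟨_, ⟨a, ha, rfl⟩, rfl⟩
    have := congrArg Subtype.val (hx a ha)
    change (a : G) * x = x * a at this
    change g * a * g⁻¹ * (g * x * g⁻¹) = g * x * g⁻¹ * (g * a * g⁻¹)
    calc _ = g * (a * x) * g⁻¹ := by group
      _ = _ := by rw [this]; group
  obtain ⟨k, hk, hkD⟩ := (isSylowIn_centralizer hB).exists_conj_mem hD ((isPGroup_map _).map _)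
  refine ⟨k * g, fun x hx => ?_, fun x hx => ?_⟩
  · have h1 : (MulAut.conj g).toMonoidHom x ∈ ambient B := by
      rw [ambient, ← hg]
      exact ⟨x, ⟨x, hx, rfl⟩, rfl⟩
    obtain ⟨y, hy, hyx⟩ := h1
    refine ⟨y, hy, ?_⟩
    have h2 := mem_centralizer_map_iff.1 hk y hy
    have h3 : (y : G) = g * x * g⁻¹ := hyx
    calc (y : G) = y * k * k⁻¹ := by group
      _ = _ := by rw [h2, h3]; group
  · obtain ⟨y, hy, h⟩ := hkD _ ⟨x, ⟨x, hx, rfl⟩, rfl⟩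
    refine ⟨y, hy, ?_⟩
    rw [show (y : G) = _ from h]
    simp [mul_assoc]

theorem conj_eq_of_mem_centralizer {A : Subgroup S.toSubgroup} {c : G}
    (hc : c ∈ centralizer (ambient A : Set G)) {u : S.toSubgroup} (hu : u ∈ A) :
    c * u * c⁻¹ = u := by
  rw [← mem_centralizer_map_iff.1 hc u hu, mul_inv_cancel_right]

end Ambient

/-! ### Elementary abelian subgroups and consequences of (a), (b), (c) -/

theorem IsElementaryAbelianOfRank.of_conj {p n : ℕ} {S : Type u} [Group S]
    {F : FusionSystem p S} {A B : Subgroup S} (hA : IsElementaryAbelianOfRank p n A)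
    (h : F.Conj A B) : IsElementaryAbelianOfRank p n B := by
  obtain ⟨e, -⟩ := h
  have hs : ∀ y ∈ B, ∃ x : A, (e x : S) = y := fun y hy => by
    obtain ⟨x, hx⟩ := e.surjective ⟨y, hy⟩
    exact ⟨x, congrArg Subtype.val hx⟩
  refine ⟨fun x hx y hy => ?_, fun x hx => ?_, ?_⟩
  · obtain ⟨x, rfl⟩ := hs x hx
    obtain ⟨y, rfl⟩ := hs y hy
    rw [← Subgroup.coe_mul, ← Subgroup.coe_mul, ← map_mul, ← map_mul]
    congr 2
    exact Subtype.ext (hA.1 x x.2 y y.2)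
  · obtain ⟨x, rfl⟩ := hs x hx
    rw [← Subgroup.coe_pow, ← map_pow, show x ^ p = 1 from Subtype.ext (hA.2.1 x x.2), map_one]
    rfl
  · rw [← hA.2.2, Nat.card_congr e.toEquiv]

theorem card_zpowers_of_pow_eq_one {S : Type u} [Group S] {p : ℕ} [Fact p.Prime] {a : S}
    (h : a ^ p = 1) (h1 : a ≠ 1) : Nat.card (zpowers a) = p := by
  rw [Nat.card_zpowers, orderOf_eq_prime h h1]

theorem IsElementaryAbelianOfRank.zpowers_sup {p n : ℕ} [Fact p.Prime] {S : Type u} [Group S]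
    {U : Subgroup S} (hU : IsElementaryAbelianOfRank p n U) {a : S} (ha : a ^ p = 1)
    (haU : a ∉ U) (hc : a ∈ centralizer (U : Set S)) :
    IsElementaryAbelianOfRank p (n + 1) (zpowers a ⊔ U) := by
  have ha1 : a ≠ 1 := fun h => haU (h ▸ U.one_mem)
  have hcomm : ∀ (x : zpowers a) (u : U), Commute ((zpowers a).subtype x) (U.subtype u) := by
    rintro ⟨_, k, rfl⟩ ⟨u, hu⟩
    exact Commute.zpow_left (hc u hu).symm k
  have hrange : (MonoidHom.noncommCoprod (zpowers a).subtype U.subtype hcomm).range =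
      zpowers a ⊔ U := by
    rw [MonoidHom.noncommCoprod_range, range_subtype, range_subtype]
  have hmem : ∀ x ∈ zpowers a ⊔ U, ∃ (k : ℤ) (u : U), x = a ^ k * u := by
    intro x hx
    rw [← hrange] at hx
    obtain ⟨⟨⟨_, k, rfl⟩, u⟩, rfl⟩ := hx
    exact ⟨k, u, rfl⟩
  have hau : ∀ (k : ℤ) (u : U), Commute (a ^ k) (u : S) := fun k u =>
    Commute.zpow_left (hc u u.2).symm k
  refine ⟨fun x hx y hy => ?_, fun x hx => ?_, ?_⟩
  · obtain ⟨k, u, rfl⟩ := hmem x hx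
    obtain ⟨l, v, rfl⟩ := hmem y hy
    exact ((((Commute.refl a).zpow_zpow k l).mul_right (hau k v)).mul_left
      ((hau l u).symm.mul_right (hU.1 u u.2 v v.2))).eq
  · obtain ⟨k, u, rfl⟩ := hmem x hx
    rw [(hau k u).mul_pow, hU.2.1 u u.2, mul_one, ← zpow_natCast, zpow_comm, zpow_natCast, ha,
      one_zpow]
  · have hinj : Function.Injective (MonoidHom.noncommCoprod (zpowers a).subtype U.subtype hcomm) := by
      rw [MonoidHom.noncommCoprod_injective, range_subtype, range_subtype]
      refine ⟨subtype_injective _, subtype_injective _, ?_⟩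
      rw [disjoint_def]
      intro x hx hxU
      by_contra hx1
      exact haU (le_of_mem_of_card_prime (card_zpowers_of_pow_eq_one ha ha1) hx hx1 hxU
        (mem_zpowers a))
    rw [← hrange, ← Nat.card_congr (MonoidHom.ofInjective hinj).toEquiv, Nat.card_prod, hU.2.2,
      card_zpowers_of_pow_eq_one ha ha1, pow_succ, mul_comm]

/-- The hypotheses on `Z`, `U`, `S₀ = C_S(U)` and `Γ` under which the automorphisms in `Γ` are
adjoined to the fusion system of `G`. -/
structure IsRankTwoExtension {G : Type u} [Group G] {p : ℕ} (S : Sylow p G)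
    (Z U S₀ : Subgroup S.toSubgroup) (Γ : Subgroup (MulAut S₀)) : Prop where
  normal : (Z.map S.toSubgroup.subtype).Normal
  card_eq : Nat.card Z = p
  rank_two : IsElementaryAbelianOfRank p 2 U
  le : Z ≤ U
  eq_centralizer : S₀ = centralizer (U : Set S.toSubgroup)
  sylow : IsSylowIn p (S₀.map S.toSubgroup.subtype)
    (centralizer (U.map S.toSubgroup.subtype : Set G))
  preserves : ∀ γ ∈ Γ, PreservesFusion (S.toSubgroup.subtype.comp S₀.subtype)
    (centralizer (U.map S.toSubgroup.subtype : Set G)) γ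
  image_eq : ∀ γ ∈ Γ, imageUnder γ.toMonoidHom U = U
  areConj : ∀ A B : Subgroup S.toSubgroup, Nat.card A = p → Nat.card B = p → A ≠ Z → B ≠ Z →
    AreConj S.toSubgroup.subtype A B
  transitive : ∀ A B : Subgroup S.toSubgroup, A ≤ U → B ≤ U → Nat.card A = p → Nat.card B = p →
    ∃ γ ∈ Γ, imageUnder γ.toMonoidHom A = B
  stabilizer : {φ : MulAut S₀ | φ ∈ Γ ∧ imageUnder φ.toMonoidHom Z = Z} =
    {φ : MulAut S₀ | φ.toMonoidHom ∈ conjHom S.toSubgroup.subtype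
      (normalizer (U.map S.toSubgroup.subtype : Set G)) S₀ S₀}
  aut : ∀ E : Subgroup S.toSubgroup, IsElementaryAbelianOfRank p 3 E → U ≤ E →
    (groupFusion S).FullyCentralized E →
    {α | α ∈ (generatedFusion (groupFusion S) S₀ Γ).Aut (centralizer (E : Set S.toSubgroup)) ∧
      imageUnder α.toMonoidHom Z = Z} =
    {α | α ∈ (groupFusion S).Aut (centralizer (E : Set S.toSubgroup))}
  areConj_of_rank_three : ∀ E E' : Subgroup S.toSubgroup, IsElementaryAbelianOfRank p 3 E →
    IsElementaryAbelianOfRank p 3 E' → U ≤ E → U ≤ E' →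
    (∃ γ ∈ Γ, imageUnder γ.toMonoidHom E = E') → AreConj S.toSubgroup.subtype E E'

namespace IsRankTwoExtension

variable {G : Type u} [Group G] {p : ℕ} {S : Sylow p G} {Z U S₀ : Subgroup S.toSubgroup}
  {Γ : Subgroup (MulAut S₀)} (D : IsRankTwoExtension S Z U S₀ Γ)
include D

theorem conj_mem_iff {g a : G} : g * a * g⁻¹ ∈ ambient Z ↔ a ∈ ambient Z := by
  refine ⟨fun h => ?_, fun h => D.normal.conj_mem a h g⟩
  have := D.normal.conj_mem _ h g⁻¹
  simpa [mul_assoc] using this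

theorem U_le : U ≤ S₀ := by
  rw [D.eq_centralizer]
  exact fun x hx y hy => D.rank_two.1 y hy x hx

theorem apply_mem_U {γ : MulAut S₀} (hγ : γ ∈ Γ) {u : S₀} (hu : (u : S.toSubgroup) ∈ U) :
    (γ u : S.toSubgroup) ∈ U := by
  have : (γ u : S.toSubgroup) ∈ imageUnder γ.toMonoidHom U := ⟨u, hu, rfl⟩
  rwa [D.image_eq γ hγ] at this

variable [Fact p.Prime]

/-- `K ∩ U` has order dividing `p²` and properly contains `Z`. Thus a condition cutting out a
subgroup need only be checked on `Z` and one element of `U` outside `Z`. -/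
theorem U_le_of_mem [Finite G] {K : Subgroup G} (hZ : ambient Z ≤ K) {b : G} (hbU : b ∈ ambient U)
    (hbZ : b ∉ ambient Z) (hbK : b ∈ K) : ambient U ≤ K := by
  have hc : Nat.card (ambient U) = p ^ 2 := card_map_subtype.trans D.rank_two.2.2
  have hZc : Nat.card (ambient Z) = p := card_map_subtype.trans D.card_eq
  have hZU : ambient Z ≤ K ⊓ ambient U := le_inf hZ (map_mono D.le)
  obtain ⟨k, hk, hk'⟩ := (Nat.dvd_prime_pow (Fact.out : p.Prime)).1
    (hc ▸ card_dvd_of_le (inf_le_right : K ⊓ ambient U ≤ ambient U))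
  have hp : 1 < p := (Fact.out : p.Prime).one_lt
  have : k = 2 := by
    by_contra h2
    have hk1 : k ≤ 1 := by omega
    have h3 : Nat.card (K ⊓ ambient U : Subgroup G) ≤ Nat.card (ambient Z) := by
      rw [hk', hZc]
      exact (Nat.pow_le_pow_right hp.le hk1).trans (pow_one p).le
    exact hbZ (eq_of_le_of_card_ge hZU h3 ▸ ⟨hbK, hbU⟩)
  rw [← eq_of_le_of_card_ge (inf_le_right : K ⊓ ambient U ≤ ambient U) (by rw [hc, hk', this])]
  exact inf_le_left

/-- A nontrivial element of `U` is moved into `Z` by `Γ`. -/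
theorem exists_apply_mem {u : S₀} (hu : (u : S.toSubgroup) ∈ U) (hu1 : (u : S.toSubgroup) ≠ 1) :
    ∃ γ ∈ Γ, (γ u : S.toSubgroup) ∈ Z := by
  obtain ⟨γ, hγ, h⟩ := D.transitive (zpowers (u : S.toSubgroup)) Z ((zpowers_le).2 hu) D.le
    (card_zpowers_of_pow_eq_one (D.rank_two.2.1 u hu) hu1) D.card_eq
  refine ⟨γ, hγ, ?_⟩
  rw [← h]
  exact ⟨u, mem_zpowers _, rfl⟩

/-- As `Z` has prime order, one nontrivial element staying in `Z` forces `γ(Z) = Z`, and (c)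
applies. -/
theorem exists_conj_of_apply_mem {γ : MulAut S₀} (hγ : γ ∈ Γ) {z : S₀}
    (hz : (z : S.toSubgroup) ∈ Z) (hz1 : z ≠ 1) (hγz : (γ z : S.toSubgroup) ∈ Z) :
    ∃ n : G, ∀ y : S₀, ((γ y : S.toSubgroup) : G) = n * y * n⁻¹ := by
  have hp : p ≠ 0 := (Fact.out : p.Prime).ne_zero
  have : Finite Z := Nat.finite_of_card_ne_zero (by rwa [D.card_eq])
  have hZ : imageUnder γ.toMonoidHom Z = Z := by
    refine imageUnder_eq_of_forall_mem (D.le.trans D.U_le) γ.injective (fun x hx => ?_) le_rfl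
    have hle := le_of_mem_of_card_prime
      (P := ((Z.subgroupOf S₀).comap γ.toMonoidHom).map S₀.subtype)
      D.card_eq hz (fun h => hz1 (Subtype.ext h)) ⟨z, hγz, rfl⟩
    obtain ⟨y, hy, hyx⟩ := hle hx
    obtain rfl : y = x := Subtype.ext hyx
    exact hy
  obtain ⟨n, -, hn⟩ : γ ∈ {φ : MulAut S₀ | φ.toMonoidHom ∈ conjHom S.toSubgroup.subtype
      (normalizer (U.map S.toSubgroup.subtype : Set G)) S₀ S₀} := by
    rw [← D.stabilizer]
    exact ⟨hγ, hZ⟩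
  exact ⟨n, hn⟩

/-- The `p`-group `S` acting on `Z` by conjugation fixes a nontrivial element, which generates `Z`.
-/
theorem Z_le_center [Finite G] : Z ≤ center S.toSubgroup := by
  have hp : 1 < p := (Fact.out : p.Prime).one_lt
  have hbot : Z ≠ ⊥ := by
    rintro rfl
    have := D.card_eq
    rw [card_bot] at this
    omega
  have hN : ∀ g, g ∈ normalizer (Z : Set S.toSubgroup) := fun g =>
    mem_normalizer_fintype fun z hz =>
      coe_mem_map_subtype.1 (D.normal.conj_mem z (coe_mem_map_subtype.2 hz) g)
  obtain ⟨a, ha1, -, ha⟩ := exists_fixed_of_isPGroup S.isPGroup' hbot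
    (FusionSystem.isPGroup_autConj (groupFusion S) Z)
  refine le_of_mem_of_card_prime D.card_eq a.2 (fun h => ha1 (Subtype.ext h))
    (mem_center_iff.2 fun g => ?_)
  have := congrArg Subtype.val (ha _ ⟨⟨g, hN g⟩, rfl⟩)
  rw [normalizerMonoidHom_apply_apply_coe] at this
  exact mul_inv_eq_iff_eq_mul.1 this

omit [Fact p.Prime] in
-- The inclusion of (c) that produces elements of `Γ` from `N_G(U)`.
theorem exists_aut_of_conj [Finite G] {n : G} (hn : n ∈ normalizer (ambient U : Set G))
    (hS₀ : ∀ y ∈ ambient S₀, n * y * n⁻¹ ∈ ambient S₀) :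
    ∃ γ ∈ Γ, ∀ y : S₀, ((γ y : S.toSubgroup) : G) = n * y * n⁻¹ := by
  let ε := S₀.equivMapOfInjective S.toSubgroup.subtype S.toSubgroup.subtype_injective
  have hε : ∀ y : S₀, ((ε y : ambient S₀) : G) = y := fun y => rfl
  have hnS : n ∈ normalizer (ambient S₀ : Set G) := mem_normalizer_fintype hS₀
  let γ : MulAut S₀ := MulAut.congr ε.symm (normalizerMonoidHom _ ⟨n, hnS⟩)
  have hγ : ∀ y : S₀, ((γ y : S.toSubgroup) : G) = n * y * n⁻¹ := fun y => by
    rw [← hε]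
    exact congrArg Subtype.val (ε.apply_symm_apply _)
  have : γ ∈ {φ : MulAut S₀ | φ ∈ Γ ∧ imageUnder φ.toMonoidHom Z = Z} := by
    rw [D.stabilizer]
    exact ⟨n, hn, hγ⟩
  exact ⟨γ, this.1, hγ⟩

omit [Fact p.Prime] in
-- Preservation of fusion is applied to the largest subgroup of `S₀` that `c` conjugates into `S₀`,
-- so a single `c'` serves all pairs `y, y'`.
theorem exists_conj_apply {γ : MulAut S₀} (hγ : γ ∈ Γ) {c : G}
    (hc : c ∈ centralizer (ambient U : Set G)) :
    ∃ c' ∈ centralizer (ambient U : Set G), ∀ y y' : S₀, (y' : G) = c * y * c⁻¹ →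
      ((γ y' : S.toSubgroup) : G) = c' * (γ y : S.toSubgroup) * c'⁻¹ := by
  let j : S₀ →* G := S.toSubgroup.subtype.comp S₀.subtype
  have hj : Function.Injective j := Subtype.val_injective.comp Subtype.val_injective
  let P : Subgroup S₀ := j.range.comap ((MulAut.conj c).toMonoidHom.comp j)
  let φ : P →* S₀ := (MonoidHom.ofInjective hj).symm.toMonoidHom.comp
    (((MulAut.conj c).toMonoidHom.comp (j.comp P.subtype)).codRestrict j.range fun x => x.2)
  have hφ : ∀ x : P, j (φ x) = c * j x * c⁻¹ := fun x =>
    congrArg Subtype.val ((MonoidHom.ofInjective hj).apply_symm_apply _)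
  have hφi : Function.Injective φ := fun x y hxy => by
    have h := hφ x
    rw [hxy, hφ y] at h
    exact Subtype.ext (hj (by simpa using h.symm))
  let α := MonoidHom.ofInjective hφi
  have hα : α.toMonoidHom ∈ conjHom j (centralizer (ambient U : Set G)) P φ.range :=
    ⟨c, hc, fun x => hφ x⟩
  obtain ⟨c', hc', h⟩ := (D.preserves γ hγ P φ.range α).1 hα
  refine ⟨c', hc', fun y y' hy => ?_⟩
  have hyP : y ∈ P := ⟨y', hy⟩
  have h1 := h (MulEquiv.subgroupMap γ P ⟨y, hyP⟩)
  have h2 : φ ⟨y, hyP⟩ = y' := hj ((hφ _).trans hy.symm)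
  have h3 : (((MulEquiv.subgroupMap γ P).symm.trans
        (α.trans (MulEquiv.subgroupMap γ φ.range))).toMonoidHom
          (MulEquiv.subgroupMap γ P ⟨y, hyP⟩) : S₀) = γ y' := by
    change γ (α ((MulEquiv.subgroupMap γ P).symm (MulEquiv.subgroupMap γ P ⟨y, hyP⟩))) = γ y'
    rw [MulEquiv.symm_apply_apply, ← h2]
    rfl
  have h4 := h1
  rw [h3] at h4
  exact h4

variable [Finite G]

/-- An element of order `p` outside `Z` can be moved into `U` by an element of `G` that moves its
centralizer in `S` into `S₀`. -/
theorem exists_conj_mem_U {a : S.toSubgroup} (hap : a ^ p = 1) (haZ : a ∉ Z) :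
    ∃ g : G, (∃ b : S₀, (b : G) = g * a * g⁻¹ ∧ (b : S.toSubgroup) ∈ U) ∧
      ∀ x : S.toSubgroup, x * a = a * x → ∃ y : S₀, (y : G) = g * x * g⁻¹ := by
  have hp : 1 < p := (Fact.out : p.Prime).one_lt
  have ha1 : a ≠ 1 := fun h => haZ (h ▸ Z.one_mem)
  obtain ⟨u, hu, huZ⟩ : ∃ u ∈ U, u ∉ Z := by
    by_contra! h
    have := card_le_of_le (show U ≤ Z from h)
    rw [D.card_eq, D.rank_two.2.2, pow_two] at this
    nlinarith
  have hu1 : u ≠ 1 := fun h => huZ (h ▸ Z.one_mem)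
  obtain ⟨g, hg⟩ := D.areConj (zpowers a) (zpowers u) (card_zpowers_of_pow_eq_one hap ha1)
    (card_zpowers_of_pow_eq_one (D.rank_two.2.1 u hu) hu1)
    (fun h => haZ (h ▸ mem_zpowers a)) (fun h => huZ (h ▸ mem_zpowers u))
  obtain ⟨b, hb, hba⟩ : (MulAut.conj g).toMonoidHom a ∈ ambient (zpowers u) := by
    rw [ambient, ← hg]
    exact ⟨a, ⟨a, mem_zpowers a, rfl⟩, rfl⟩
  have hbU : b ∈ U := (zpowers_le).2 hu hb
  replace hba : (b : G) = g * a * g⁻¹ := hba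
  have hbZ : (b : G) ∉ ambient Z := by
    rw [hba, D.conj_mem_iff, coe_mem_map_subtype]
    exact haZ
  -- If `x ∈ S` centralizes `a`, then `g x g⁻¹` centralizes `b ∈ U` outside `Z`, and also `Z`, which
  -- is central in `S` and normal in `G`; hence it centralizes `U`. A Sylow conjugation by `c ∈
  -- C_G(U)` then reaches `S₀` without moving `b`.
  have hle : (ambient (centralizer {a})).map (MulAut.conj g).toMonoidHom ≤
      centralizer (ambient U : Set G) := by
    rintro _ ⟨_, ⟨x, hx, rfl⟩, rfl⟩
    change g * x * g⁻¹ ∈ _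
    have hxa := congrArg Subtype.val (mem_centralizer_singleton_iff.1 hx)
    have h1 : ambient U ≤ centralizer {g * x * g⁻¹} := by
      refine D.U_le_of_mem ?_ (coe_mem_map_subtype.2 hbU) hbZ ?_
      · intro w hw
        have hw' : g⁻¹ * w * g⁻¹⁻¹ ∈ ambient Z := D.conj_mem_iff.2 hw
        obtain ⟨z, hz, hzw⟩ := hw'
        have h2 := congrArg Subtype.val (mem_center_iff.1 (D.Z_le_center hz) x)
        change (x : G) * z = z * x at h2
        replace hzw : (z : G) = g⁻¹ * w * g⁻¹⁻¹ := hzw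
        rw [hzw] at h2
        rw [mem_centralizer_singleton_iff]
        calc w * (g * x * g⁻¹) = g * (g⁻¹ * w * g⁻¹⁻¹ * x) * g⁻¹ := by group
          _ = _ := by rw [← h2]; group
      · rw [mem_centralizer_singleton_iff, hba]
        change (x : G) * a = a * x at hxa
        calc g * a * g⁻¹ * (g * x * g⁻¹) = g * (a * x) * g⁻¹ := by group
          _ = _ := by rw [← hxa]; group
    exact fun v hv => mem_centralizer_singleton_iff.1 (h1 hv)
  obtain ⟨c, hc, hcD⟩ := D.sylow.exists_conj_mem hle ((isPGroup_map _).map _)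
  refine ⟨c * g, ⟨⟨b, D.U_le hbU⟩, ?_, hbU⟩, fun x hx => ?_⟩
  · have := conj_eq_of_mem_centralizer hc hbU
    rw [hba] at this
    rw [show (((⟨b, D.U_le hbU⟩ : S₀) : S.toSubgroup) : G) = b from rfl, hba]
    nth_rewrite 1 [← this]
    group
  · obtain ⟨y, hy, hyx⟩ := hcD _ ⟨x, ⟨x, mem_centralizer_singleton_iff.2 hx, rfl⟩, rfl⟩
    refine ⟨⟨y, hy⟩, ?_⟩
    rw [show (((⟨y, hy⟩ : S₀) : S.toSubgroup) : G) = _ from hyx]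
    simp [mul_assoc]

end IsRankTwoExtension

/-! ### Standard maps into `Z` and compatibility with them -/

section Transport

variable {G : Type u} [Group G] {p : ℕ} {S : Sylow p G} {Z U S₀ : Subgroup S.toSubgroup}
  {Γ : Subgroup (MulAut S₀)} {P : Set G} {a : G} {f k l : G → G}

/-- On `P`, the function `f` is a standard map moving `a` into `Z`: a conjugation if `a` is already
in `Z`, and otherwise, up to a final conjugation, a conjugation that moves `P` into `S₀` and `a`
into `U`, followed by an element of `Γ`. -/
def IsTransport (Z U : Subgroup S.toSubgroup) (Γ : Subgroup (MulAut S₀)) (P : Set G) (a : G)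
    (f : G → G) : Prop :=
  (a ∈ ambient Z ∧ ∃ g : G, ∀ x ∈ P, f x = g * x * g⁻¹) ∨
  (a ∉ ambient Z ∧ ∃ g h : G, ∃ γ ∈ Γ,
    (∃ u : S₀, (u : G) = g * a * g⁻¹ ∧ (u : S.toSubgroup) ∈ U ∧ (γ u : S.toSubgroup) ∈ Z) ∧
    ∀ x ∈ P, ∃ y : S₀, (y : G) = g * x * g⁻¹ ∧ f x = h * (γ y : S.toSubgroup) * h⁻¹)

/-- The function `k` is compatible on `P` with the standard maps moving `a` and `k a` into `Z`. -/
def IsCompatible (Z U : Subgroup S.toSubgroup) (Γ : Subgroup (MulAut S₀)) (P : Set G) (a : G)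
    (k : G → G) : Prop :=
  ∃ f, IsTransport Z U Γ (k '' P) (k a) f ∧ IsTransport Z U Γ P a (f ∘ k)

/-- `a` is an element of `S` of order `p`, which is centralized by the subset `P` of `S`. -/
def IsCentralizedBy (S : Sylow p G) (P : Set G) (a : G) : Prop :=
  a ∈ S.toSubgroup ∧ a ≠ 1 ∧ a ^ p = 1 ∧ ∀ x ∈ P, x ∈ S.toSubgroup ∧ x * a = a * x

/-- Standard maps may be followed by a conjugation. -/
theorem IsTransport.conj (h : IsTransport Z U Γ P a f) {f' : G → G} (m : G)
    (hf : ∀ x ∈ P, f' x = m * f x * m⁻¹) : IsTransport Z U Γ P a f' := by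
  rcases h with ⟨ha, g, h⟩ | ⟨ha, g, h', γ, hγ, hu, h⟩
  · refine .inl ⟨ha, m * g, fun x hx => ?_⟩
    rw [hf x hx, h x hx]
    group
  · refine .inr ⟨ha, g, m * h', γ, hγ, hu, fun x hx => ?_⟩
    obtain ⟨y, hy, hyx⟩ := h x hx
    refine ⟨y, hy, ?_⟩
    rw [hf x hx, hyx]
    group

theorem IsTransport.congr (h : IsTransport Z U Γ P a f) {f' : G → G}
    (hf : ∀ x ∈ P, f' x = f x) : IsTransport Z U Γ P a f' :=
  h.conj 1 fun x hx => by rw [hf x hx]; group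

namespace IsRankTwoExtension

variable (D : IsRankTwoExtension S Z U S₀ Γ)
include D

/-- Standard maps may be preceded by a conjugation. -/
theorem isTransport_comp {P' : Set G} {g : G} (h : IsTransport Z U Γ P' (g * a * g⁻¹) f)
    (hP : ∀ x ∈ P, g * x * g⁻¹ ∈ P') {f' : G → G} (hf : ∀ x ∈ P, f' x = f (g * x * g⁻¹)) :
    IsTransport Z U Γ P a f' := by
  rw [IsTransport, D.conj_mem_iff] at h
  rcases h with ⟨ha, k, h⟩ | ⟨ha, k, h', γ, hγ, ⟨u, hu, hu'⟩, h⟩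
  · refine .inl ⟨ha, k * g, fun x hx => ?_⟩
    rw [hf x hx, h _ (hP x hx)]
    group
  · refine .inr ⟨ha, k * g, h', γ, hγ, ⟨u, by rw [hu]; group, hu'⟩, fun x hx => ?_⟩
    obtain ⟨y, hy, hyx⟩ := h _ (hP x hx)
    exact ⟨y, by rw [hy]; group, by rw [hf x hx, hyx]⟩

variable [Fact p.Prime]

/-- For `a ∈ U`, every `δ ∈ Γ` with `δ a ∈ Z` is itself standard: by definition if `a ∉ Z`, and by
(c) if `a ∈ Z`. Choosing `δ` to move `γ a` into `Z`, both `δ` and `δ γ` are standard. -/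
theorem isCompatible_extendAut_of_mem_U {γ : MulAut S₀} (hγ : γ ∈ Γ)
    (hP : ∀ x ∈ P, x ∈ ambient S₀) (ha : a ∈ ambient U) (ha1 : a ≠ 1) :
    IsCompatible Z U Γ P a (extendAut γ) := by
  obtain ⟨u, hu, rfl⟩ := ha
  lift u to S₀ using D.U_le hu
  have hu1 : u ≠ 1 := fun h => ha1 (by rw [h]; rfl)
  replace hP : ∀ x ∈ P, ∃ y : S₀, (y : G) = x := fun x hx => by
    obtain ⟨y, hy, rfl⟩ := hP x hx
    exact ⟨⟨y, hy⟩, rfl⟩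
  have key : ∀ δ ∈ Γ, (δ u : S.toSubgroup) ∈ Z → ∀ f : G → G,
      (∀ y : S₀, f y = (δ y : S.toSubgroup)) → IsTransport Z U Γ P (u : S.toSubgroup) f := by
    intro δ hδ hδu f hf
    by_cases huZ : ((u : S.toSubgroup) : G) ∈ ambient Z
    · obtain ⟨n, hn⟩ := D.exists_conj_of_apply_mem hδ (coe_mem_map_subtype.1 huZ) hu1 hδu
      refine .inl ⟨huZ, n, fun x hx => ?_⟩
      obtain ⟨y, rfl⟩ := hP x hx
      rw [hf, hn]
    · refine .inr ⟨huZ, 1, 1, δ, hδ, ⟨u, by simp, hu, hδu⟩, fun x hx => ?_⟩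
      obtain ⟨y, rfl⟩ := hP x hx
      exact ⟨y, by simp, by simp [hf]⟩
  change IsCompatible Z U Γ P ((u : S.toSubgroup) : G) _
  by_cases hγu : (γ u : S.toSubgroup) ∈ Z
  · refine ⟨id, .inl ⟨?_, 1, by simp⟩, key γ hγ hγu _ fun y => extendAut_apply γ y⟩
    rw [extendAut_apply]
    exact coe_mem_map_subtype.2 hγu
  · obtain ⟨δ, hδ, hδu⟩ := D.exists_apply_mem (D.apply_mem_U hγ hu) fun h =>
      hu1 (γ.injective ((Subtype.ext h : γ u = 1).trans (map_one γ).symm))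
    refine ⟨extendAut δ, ?_, key (δ * γ) (Γ.mul_mem hδ hγ) hδu _ fun y => ?_⟩
    · rw [extendAut_apply]
      refine .inr ⟨fun h => hγu (coe_mem_map_subtype.1 h), 1, 1, δ, hδ,
        ⟨γ u, by simp, D.apply_mem_U hγ hu, hδu⟩, ?_⟩
      rintro _ ⟨x, hx, rfl⟩
      obtain ⟨y, rfl⟩ := hP x hx
      exact ⟨γ y, by simp [extendAut_apply], by simp [extendAut_apply]⟩
    · simp [extendAut_apply]

variable [Finite G]

/-- Any two standard maps for the same element differ by a conjugation. -/
theorem isTransport_unique {f' : G → G} (h : IsTransport Z U Γ P a f)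
    (h' : IsTransport Z U Γ P a f') : ∃ m : G, ∀ x ∈ P, f' x = m * f x * m⁻¹ := by
  rcases h with ⟨ha, g, h⟩ | ⟨ha, g, r, γ, hγ, ⟨u, hu, huU, huZ⟩, h⟩
  · rcases h' with ⟨-, g', h'⟩ | ⟨ha', -⟩
    · refine ⟨g' * g⁻¹, fun x hx => ?_⟩
      rw [h x hx, h' x hx]
      group
    · exact absurd ha ha'
  rcases h' with ⟨ha', -⟩ | ⟨-, g', r', γ', hγ', ⟨u', hu', huU', huZ'⟩, h'⟩
  · exact absurd ha' ha
  -- `g' g⁻¹` preserves `Z` and sends `u ∈ U` outside `Z` to `u' ∈ U`.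
  have hk : g' * g⁻¹ ∈ normalizer (ambient U : Set G) := by
    refine mem_normalizer_fintype fun v hv => ?_
    have huZ₀ : (u : G) ∉ ambient Z := by rwa [hu, D.conj_mem_iff]
    have h1 : ambient U ≤ (ambient U).comap (MulAut.conj (g' * g⁻¹)).toMonoidHom := by
      refine D.U_le_of_mem (fun w hw => ?_) (coe_mem_map_subtype.2 huU) huZ₀ ?_
      · exact map_mono D.le (D.conj_mem_iff.2 hw)
      · change g' * g⁻¹ * u * (g' * g⁻¹)⁻¹ ∈ ambient U
        convert coe_mem_map_subtype.2 huU' using 1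
        rw [hu, hu']
        group
    exact h1 hv
  have hS₀U : ambient S₀ ≤ centralizer (ambient U : Set G) := D.sylow.1
  have hle : (ambient S₀).map (MulAut.conj (g' * g⁻¹)).toMonoidHom ≤
      centralizer (ambient U : Set G) := by
    rintro _ ⟨y, hy, rfl⟩ v hv
    have h1 := hS₀U hy _ ((mem_normalizer_iff''.1 hk v).1 hv)
    change v * (g' * g⁻¹ * y * (g' * g⁻¹)⁻¹) = g' * g⁻¹ * y * (g' * g⁻¹)⁻¹ * v
    calc v * (g' * g⁻¹ * y * (g' * g⁻¹)⁻¹) =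
        g' * g⁻¹ * ((g' * g⁻¹)⁻¹ * v * (g' * g⁻¹) * y) * (g' * g⁻¹)⁻¹ := by group
      _ = _ := by rw [h1]; group
  -- `g' g⁻¹` need not normalize `S₀`; correcting it by `c ∈ C_G(U)` gives an element that does, and
  -- by (c) this induces some `ν ∈ Γ`.
  obtain ⟨c, hc, hcS⟩ := D.sylow.exists_conj_mem hle ((isPGroup_map _).map _)
  have hcN : c ∈ normalizer (ambient U : Set G) := centralizer_le_normalizer _ hc
  obtain ⟨ν, hν, hνn⟩ := D.exists_aut_of_conj (mul_mem hcN hk) fun y hy => by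
    convert hcS _ ⟨y, hy, rfl⟩ using 1
    change _ = c * (g' * g⁻¹ * y * (g' * g⁻¹)⁻¹) * c⁻¹
    group
  have hνu : ν u = u' := by
    refine Subtype.ext (Subtype.ext ?_)
    rw [hνn, ← conj_eq_of_mem_centralizer hc huU', hu, hu']
    group
  -- This automorphism sends `γ u` to `γ' u'`, both in `Z`.
  obtain ⟨n, hn⟩ := D.exists_conj_of_apply_mem (γ := γ' * ν * γ⁻¹)
    (Γ.mul_mem (Γ.mul_mem hγ' hν) (Γ.inv_mem hγ)) huZ (by
      intro h1
      have h2 : u = 1 := γ.injective (h1.trans (map_one γ).symm)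
      apply ha
      have h3 : a = g⁻¹ * (u : G) * g := by rw [hu]; group
      rw [h3, h2]
      simp) (by simpa [hνu] using huZ')
  -- Since `y' = c⁻¹ (ν y) c`, the correction `c` is pushed through `γ'`, where it becomes
  -- conjugation by `c'`.
  obtain ⟨c', -, hc'⟩ := D.exists_conj_apply hγ' (inv_mem hc)
  refine ⟨r' * c' * n * r⁻¹, fun x hx => ?_⟩
  obtain ⟨y, hy, hyf⟩ := h x hx
  obtain ⟨y', hy', hyf'⟩ := h' x hx
  have h1 := hc' (ν y) y' (by rw [hνn, hy, hy']; group)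
  have h2 := hn (γ y)
  simp only [MulAut.mul_apply, MulAut.inv_apply_self] at h2
  rw [hyf', h1, h2, hyf]
  group

theorem exists_isTransport (ha : IsCentralizedBy S P a) : ∃ f, IsTransport Z U Γ P a f := by
  obtain ⟨haS, ha1, hap, hP⟩ := ha
  by_cases haZ : a ∈ ambient Z
  · exact ⟨id, .inl ⟨haZ, 1, by simp⟩⟩
  lift a to S.toSubgroup using haS
  obtain ⟨g, ⟨b, hb, hbU⟩, hg⟩ := D.exists_conj_mem_U (Subtype.ext hap)
    fun h => haZ (coe_mem_map_subtype.2 h)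
  obtain ⟨γ, hγ, hγb⟩ := D.exists_apply_mem hbU fun h => ha1 (by
    have h3 : (a : G) = g⁻¹ * (b : G) * g := by rw [hb]; group
    rw [h3, h]
    simp)
  refine ⟨fun x => extendAut γ (g * x * g⁻¹), .inr ⟨haZ, g, 1, γ, hγ, ⟨b, hb, hbU, hγb⟩,
    fun x hx => ?_⟩⟩
  obtain ⟨y, hy⟩ := hg ⟨x, (hP x hx).1⟩ (Subtype.ext (hP x hx).2)
  exact ⟨y, hy, by
    beta_reduce
    rw [← show (y : G) = g * x * g⁻¹ from hy, extendAut_apply]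
    group⟩

/-- On `k(P)` both `f₁` and `f₂ ∘ l` are standard for `k a`, so they differ by a conjugation;
composing with `k`, `f₂ ∘ l ∘ k` is `f₁ ∘ k` followed by that conjugation. -/
theorem isCompatible_comp (hk : IsCompatible Z U Γ P a k)
    (hl : IsCompatible Z U Γ (k '' P) (k a) l) : IsCompatible Z U Γ P a (l ∘ k) := by
  obtain ⟨f₁, h1, h2⟩ := hk
  obtain ⟨f₂, h3, h4⟩ := hl
  obtain ⟨m, hm⟩ := D.isTransport_unique h1 h4
  exact ⟨f₂, by rwa [Set.image_comp], h2.conj m fun x hx => hm _ ⟨x, hx, rfl⟩⟩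

omit D [Fact p.Prime] [Finite G] in
theorem _root_.IsCompatible.congr (hk : IsCompatible Z U Γ P a k) (ha : a ∈ P)
    (h : ∀ x ∈ P, l x = k x) : IsCompatible Z U Γ P a l := by
  obtain ⟨f, h1, h2⟩ := hk
  refine ⟨f, ?_, h2.congr fun x hx => by rw [Function.comp_apply, Function.comp_apply, h x hx]⟩
  rwa [Set.image_congr h, h a ha]

theorem isCompatible_conj {g : G}
    (h : IsCentralizedBy S ((fun x => g * x * g⁻¹) '' P) (g * a * g⁻¹)) :
    IsCompatible Z U Γ P a (fun x => g * x * g⁻¹) := by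
  obtain ⟨f, hf⟩ := D.exists_isTransport h
  exact ⟨f, hf, D.isTransport_comp hf (fun x hx => ⟨x, hx, rfl⟩) fun x hx => rfl⟩

end IsRankTwoExtension

end Transport

/-! ### Subgroups of rank three and compatibility of `Γ`, using (d) and (e) -/

section Extension

variable {G : Type u} [Group G] {p : ℕ} {S : Sylow p G}

/-- The function `f` on `G` restricts to a morphism of `F` from `P` to `S`. -/
def FusionSystem.AmbientMor (F : FusionSystem p S.toSubgroup) (P : Subgroup S.toSubgroup)
    (f : G → G) : Prop :=
  ∃ f' : S.toSubgroup → S.toSubgroup, F.Mor P f' ∧ ∀ x ∈ P, f x = f' x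

theorem FusionSystem.AmbientMor.comp {F : FusionSystem p S.toSubgroup}
    {P Q : Subgroup S.toSubgroup} {f g : G → G} (hg : F.AmbientMor Q g) (hf : F.AmbientMor P f)
    (h : ∀ x ∈ P, ∃ y ∈ Q, (y : G) = f x) : F.AmbientMor P (g ∘ f) := by
  obtain ⟨f', hf, h1⟩ := hf
  obtain ⟨g', hg, h2⟩ := hg
  have hQ : ∀ x ∈ P, f' x ∈ Q := fun x hx => by
    obtain ⟨y, hy, h3⟩ := h x hx
    rw [h1 x hx] at h3
    exact Subtype.ext h3 ▸ hy
  exact ⟨_, hg.comp hf hQ, fun x hx => by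
    rw [Function.comp_apply, h1 x hx, h2 _ (hQ x hx)]; rfl⟩

theorem FusionSystem.AmbientMor.exists_aut [Finite G] {F : FusionSystem p S.toSubgroup}
    {P : Subgroup S.toSubgroup} {f : G → G} (hf : F.AmbientMor P f)
    (h : ∀ x ∈ P, ∃ y ∈ P, (y : G) = f x) :
    ∃ α ∈ F.Aut P, ∀ x : P, ((α x : S.toSubgroup) : G) = f x := by
  obtain ⟨f', hf, h1⟩ := hf
  have hP : ∀ x ∈ P, f' x ∈ P := fun x hx => by
    obtain ⟨y, hy, h3⟩ := h x hx
    rw [h1 x hx] at h3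
    exact Subtype.ext h3 ▸ hy
  obtain ⟨α, hα, h2⟩ := hf.exists_equiv_of_image hP (hf.surjOn le_rfl hP le_rfl)
  exact ⟨α, hα, fun x => by rw [h2, h1 x x.2]⟩

variable {Z U S₀ : Subgroup S.toSubgroup} {Γ : Subgroup (MulAut S₀)}
  {P E : Subgroup S.toSubgroup}

theorem mem_imageUnder_aut {γ : MulAut S₀} {x : S₀} :
    (γ x : S.toSubgroup) ∈ imageUnder γ.toMonoidHom P ↔ (x : S.toSubgroup) ∈ P := by
  constructor
  · rintro ⟨y, hy, hyx⟩
    have : y = x := γ.injective (Subtype.ext hyx)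
    exact this ▸ hy
  · exact fun h => ⟨x, h, rfl⟩

theorem exists_mor_imageUnder {γ : MulAut S₀} (hγ : γ ∈ Γ) (hP : P ≤ S₀) :
    ∃ f, (generatedFusion (groupFusion S) S₀ Γ).Mor P f ∧
      ∀ x : S₀, (x : S.toSubgroup) ∈ P → f x = γ x := by
  have hle : imageUnder γ.toMonoidHom P ≤ S₀ := by
    rintro _ ⟨y, -, rfl⟩
    exact (γ y).2
  let φ : P →* imageUnder γ.toMonoidHom P :=
    ((S₀.subtype.comp γ.toMonoidHom).comp (inclusion hP)).codRestrict _ fun x =>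
      mem_imageUnder_aut.2 x.2
  have hφ : φ ∈ (generatedFusion (groupFusion S) S₀ Γ).Hom P (imageUnder γ.toMonoidHom P) := by
    refine GenHom.restr hP hle φ γ hγ ?_ fun x => rfl
    rintro ⟨_, y, hy, rfl⟩
    exact ⟨⟨y, hy⟩, rfl⟩
  obtain ⟨f, hf, h⟩ := FusionSystem.exists_mor hφ
  exact ⟨f, hf, fun x hx => h ⟨x, hx⟩⟩

theorem conj_imageUnder {γ : MulAut S₀} (hγ : γ ∈ Γ) (hP : P ≤ S₀) :
    (generatedFusion (groupFusion S) S₀ Γ).Conj P (imageUnder γ.toMonoidHom P) := by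
  obtain ⟨f, hf, h⟩ := exists_mor_imageUnder hγ hP
  refine FusionSystem.conj_iff.2 ⟨f, hf, fun x hx => ?_, ?_⟩
  · rw [h ⟨x, hP hx⟩ hx]
    exact mem_imageUnder_aut.2 hx
  · rintro _ ⟨x, hx, rfl⟩
    exact ⟨x, hx, h x hx⟩

theorem ambientMor_extendAut {γ : MulAut S₀} (hγ : γ ∈ Γ) (hP : P ≤ S₀) :
    (generatedFusion (groupFusion S) S₀ Γ).AmbientMor P (extendAut γ) := by
  obtain ⟨f, hf, h⟩ := exists_mor_imageUnder hγ hP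
  refine ⟨f, hf, fun x hx => ?_⟩
  rw [h ⟨x, hP hx⟩ hx, ← extendAut_apply]

theorem groupFusion_hom_le (P Q : Subgroup S.toSubgroup) :
    (groupFusion S).Hom P Q ⊆ (generatedFusion (groupFusion S) S₀ Γ).Hom P Q :=
  fun _ h => .base _ h

theorem ambientMor_conj {g : G} (h : ∀ x ∈ P, g * x * g⁻¹ ∈ S.toSubgroup) :
    (generatedFusion (groupFusion S) S₀ Γ).AmbientMor P (fun x => g * x * g⁻¹) := by
  obtain ⟨f, hf, h⟩ := exists_groupFusion_mor h
  exact ⟨f, hf.of_le groupFusion_hom_le, fun x hx => (h x hx).symm⟩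

namespace IsRankTwoExtension

variable (D : IsRankTwoExtension S Z U S₀ Γ)
include D

theorem le_of_rank_three (hE : IsElementaryAbelianOfRank p 3 E) (hUE : U ≤ E) : E ≤ S₀ := by
  rw [D.eq_centralizer]
  exact fun x hx u hu => hE.1 u (hUE hu) x hx

theorem centralizer_le (hUE : U ≤ E) : centralizer (E : Set S.toSubgroup) ≤ S₀ := by
  rw [D.eq_centralizer]
  exact Subgroup.centralizer_le hUE

theorem le_imageUnder (hUE : U ≤ E) {γ : MulAut S₀} (hγ : γ ∈ Γ) :
    U ≤ imageUnder γ.toMonoidHom E := by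
  rw [← D.image_eq γ hγ]
  rintro _ ⟨x, hx, rfl⟩
  exact ⟨x, hUE hx, rfl⟩

variable [Fact p.Prime] [Finite G]

/-- Applying `γ ∈ Γ` to a conjugate `E₁` of a fully centralized subgroup `E` of rank three can be
corrected by a conjugation back to `E`. -/
theorem exists_conj_imageUnder {E₁ : Subgroup S.toSubgroup}
    (hE₁ : IsElementaryAbelianOfRank p 3 E₁) (hUE₁ : U ≤ E₁)
    (hEc : (groupFusion S).FullyCentralized E) (hc : AreConj S.toSubgroup.subtype E₁ E)
    {γ : MulAut S₀} (hγ : γ ∈ Γ) :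
    ∃ h : G, (∀ x : S₀, (x : S.toSubgroup) ∈ E₁ →
        ∃ y ∈ E, (y : G) = h * (γ x : S.toSubgroup) * h⁻¹) ∧
      (∀ x : S₀, (x : S.toSubgroup) ∈ centralizer (E₁ : Set S.toSubgroup) →
        ∃ y ∈ centralizer (E : Set S.toSubgroup), (y : G) = h * (γ x : S.toSubgroup) * h⁻¹) ∧
      (generatedFusion (groupFusion S) S₀ Γ).AmbientMor (centralizer (E₁ : Set S.toSubgroup))
        (fun x => h * extendAut γ x * h⁻¹) := by
  have hE₁S := D.le_of_rank_three hE₁ hUE₁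
  -- By (e), `γ(E₁)` is `G`-conjugate to `E₁`, hence to `E`.
  have hc₂ := (D.areConj_of_rank_three _ _ hE₁ (hE₁.of_conj (conj_imageUnder hγ hE₁S)) hUE₁
    (D.le_imageUnder hUE₁ hγ) ⟨γ, hγ, rfl⟩).symm.trans hc
  obtain ⟨h, h1, h2⟩ := hc₂.exists_conj_centralizer hEc
  have h3 : ∀ x : S₀, (x : S.toSubgroup) ∈ centralizer (E₁ : Set S.toSubgroup) →
      (γ x : S.toSubgroup) ∈ centralizer (imageUnder γ.toMonoidHom E₁ : Set S.toSubgroup) := by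
    rintro x hx _ ⟨y, hy, rfl⟩
    have : y * x = x * y := Subtype.ext (hx y hy)
    have := congrArg (fun z => ((γ z : S₀) : S.toSubgroup)) this
    simpa using this
  refine ⟨h, fun x hx => h1 _ (mem_imageUnder_aut.2 hx), fun x hx => h2 _ (h3 x hx), ?_⟩
  refine (ambientMor_conj (P := centralizer (imageUnder γ.toMonoidHom E₁ : Set S.toSubgroup))
    fun x hx => ?_).comp (ambientMor_extendAut hγ (D.centralizer_le hUE₁)) fun x hx => ?_
  · obtain ⟨y, -, hy⟩ := h2 x hx
    exact hy ▸ y.2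
  · lift x to S₀ using D.centralizer_le hUE₁ hx
    exact ⟨_, h3 x hx, (extendAut_apply γ x).symm⟩

/-- Each nontrivial element of a fully centralized subgroup `E ≥ U` of rank three is moved into `Z`
by an automorphism of `C_S(E)` in the extended fusion system. -/
theorem exists_aut_isTransport (hE : IsElementaryAbelianOfRank p 3 E) (hUE : U ≤ E)
    (hEc : (groupFusion S).FullyCentralized E) {a : S.toSubgroup} (ha : a ∈ E) (ha1 : a ≠ 1) :
    ∃ β : G → G, (generatedFusion (groupFusion S) S₀ Γ).AmbientMor
        (centralizer (E : Set S.toSubgroup)) β ∧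
      (∀ x ∈ centralizer (E : Set S.toSubgroup),
        ∃ y ∈ centralizer (E : Set S.toSubgroup), (y : G) = β x) ∧
      β a ∈ ambient Z ∧ IsTransport Z U Γ (ambient (centralizer (E : Set S.toSubgroup))) a β := by
  by_cases haZ : a ∈ Z
  · exact ⟨id, ⟨id, FusionSystem.mor_id, fun x _ => rfl⟩, fun x hx => ⟨x, hx, rfl⟩,
      coe_mem_map_subtype.2 haZ, .inl ⟨coe_mem_map_subtype.2 haZ, 1, by simp⟩⟩
  obtain ⟨g, ⟨b, hb, hbU⟩, hg⟩ := D.exists_conj_mem_U (hE.2.1 a ha) haZ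
  have hgE : ∀ x ∈ E, ∃ y : S₀, (y : G) = g * x * g⁻¹ := fun x hx => hg x (hE.1 x hx a ha)
  have hgC : ∀ x ∈ centralizer (E : Set S.toSubgroup), ∃ y : S₀, (y : G) = g * x * g⁻¹ :=
    fun x hx => hg x (hx a ha).symm
  have hb1 : (b : S.toSubgroup) ≠ 1 := fun h => ha1 (Subtype.ext (by
    have h3 : (a : G) = g⁻¹ * (b : G) * g := by rw [hb]; group
    rw [h3, h]
    simp))
  obtain ⟨f, hf, hfg⟩ := exists_groupFusion_mor (S := S) (P := E) (g := g) fun x hx => by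
    obtain ⟨y, hy⟩ := hgE x hx
    exact hy ▸ (y : S.toSubgroup).2
  obtain ⟨E₁, k1, k2⟩ := hf.exists_image
  have hE₁ := hE.of_conj (FusionSystem.conj_iff.2 ⟨f, hf, k1, k2⟩)
  have hUE₁ : U ≤ E₁ := by
    have : ambient U ≤ ambient E₁ := by
      refine D.U_le_of_mem ?_ (b := b) (coe_mem_map_subtype.2 hbU) ?_ ?_
      · rintro w hw
        have hw' : g⁻¹ * w * g⁻¹⁻¹ ∈ ambient Z := D.conj_mem_iff.2 hw
        obtain ⟨z, hz, hzw⟩ := hw'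
        refine ⟨f z, k1 z (hUE (D.le hz)), (hfg z (hUE (D.le hz))).trans ?_⟩
        rw [show (z : G) = _ from hzw]
        group
      · rwa [hb, D.conj_mem_iff, coe_mem_map_subtype]
      · rw [hb, ← hfg a ha]
        exact coe_mem_map_subtype.2 (k1 a ha)
    exact fun u hu => coe_mem_map_subtype.1 (this (coe_mem_map_subtype.2 hu))
  have hc : AreConj S.toSubgroup.subtype E₁ E := by
    refine (areConj_of_forall (g := g) (fun x hx => ⟨f x, k1 x hx, hfg x hx⟩) fun y hy => ?_).symm
    obtain ⟨x, hx, rfl⟩ := k2 y hy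
    exact ⟨x, hx, hfg x hx⟩
  have hCC : ∀ x ∈ centralizer (E : Set S.toSubgroup), ∀ y : S₀, (y : G) = g * x * g⁻¹ →
      (y : S.toSubgroup) ∈ centralizer (E₁ : Set S.toSubgroup) := by
    intro x hx y hy e he
    obtain ⟨e, he', rfl⟩ := k2 e he
    have h1 := congrArg Subtype.val (hx e he')
    change (e : G) * x = x * e at h1
    refine Subtype.ext ?_
    rw [Subgroup.coe_mul, Subgroup.coe_mul, hfg e he', hy]
    calc g * e * g⁻¹ * (g * x * g⁻¹) = g * (e * x) * g⁻¹ := by group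
      _ = _ := by rw [h1]; group
  obtain ⟨γ, hγ, hγb⟩ := D.exists_apply_mem hbU hb1
  -- Conjugation by `g` takes `C_S(E)` into `C_S(E₁)`, `γ` puts `b` into `Z`, and `h` leads back to
  -- `C_S(E)` while preserving the normal subgroup `Z`.
  obtain ⟨h, -, h2, h3⟩ := D.exists_conj_imageUnder hE₁ hUE₁ hEc hc hγ
  refine ⟨_, h3.comp (ambientMor_conj (g := g) fun x hx => ?_) fun x hx => ?_, fun x hx => ?_,
    ?_, ?_⟩
  · obtain ⟨y, hy⟩ := hgC x hx
    exact hy ▸ (y : S.toSubgroup).2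
  · obtain ⟨y, hy⟩ := hgC x hx
    exact ⟨y, hCC x hx y hy, hy⟩
  · obtain ⟨y, hy⟩ := hgC x hx
    rw [Function.comp_apply, ← hy, extendAut_apply]
    exact h2 y (hCC x hx y hy)
  · rw [Function.comp_apply, ← hb, extendAut_apply, D.conj_mem_iff]
    exact coe_mem_map_subtype.2 hγb
  · refine .inr ⟨fun h => haZ (coe_mem_map_subtype.1 h), g, h, γ, hγ, ⟨b, hb, hbU, hγb⟩, ?_⟩
    rintro _ ⟨x, hx, rfl⟩
    obtain ⟨y, hy⟩ := hgC x hx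
    exact ⟨y, hy, by rw [Function.comp_apply, subtype_apply, ← hy, extendAut_apply]⟩

/-- After a conjugation by `h`, `γ` becomes an `F`-automorphism `α` of `C_S(E)` with `α a = a'`.
Standard maps for `a` and `a'` can be taken to be `F`-automorphisms `b`, `b'` of `C_S(E)`. Then `b'
α b⁻¹` stabilizes `Z`, so (d) makes it a conjugation, and `b' α` is standard because `b` is. -/
theorem isCompatible_extendAut_of_fullyCentralized (hE : IsElementaryAbelianOfRank p 3 E)
    (hUE : U ≤ E) (hEc : (groupFusion S).FullyCentralized E) {a : S.toSubgroup} (ha : a ∈ E)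
    (ha1 : a ≠ 1) {γ : MulAut S₀} (hγ : γ ∈ Γ) :
    IsCompatible Z U Γ (ambient (centralizer (E : Set S.toSubgroup))) a (extendAut γ) := by
  have hES := D.le_of_rank_three hE hUE
  have hEC : E ≤ centralizer (E : Set S.toSubgroup) := fun x hx y hy => hE.1 y hy x hx
  have hCS := D.centralizer_le hUE
  obtain ⟨h, h1, h2, h3⟩ := D.exists_conj_imageUnder hE hUE hEc (.refl E) hγ
  obtain ⟨β, hβ, hβC, hβa, hβt⟩ := D.exists_aut_isTransport hE hUE hEc ha ha1
  obtain ⟨a', ha', haa'⟩ := h1 ⟨a, hES ha⟩ ha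
  have ha1' : a' ≠ 1 := by
    rintro rfl
    have h4 : ((γ ⟨a, hES ha⟩ : S.toSubgroup) : G) = 1 := by
      simpa [mul_inv_eq_one] using haa'.symm
    have h5 : γ ⟨a, hES ha⟩ = 1 := Subtype.ext (Subtype.ext h4)
    exact ha1 (congrArg Subtype.val (γ.injective (h5.trans (map_one γ).symm)))
  obtain ⟨β', hβ', hβC', hβa', hβt'⟩ := D.exists_aut_isTransport hE hUE hEc ha' ha1'
  obtain ⟨α, hα, hα'⟩ := h3.exists_aut fun x hx => by
    lift x to S₀ using hCS hx
    rw [extendAut_apply]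
    exact h2 x hx
  obtain ⟨b, hb, hb'⟩ := hβ.exists_aut hβC
  obtain ⟨b', hbF', hbb'⟩ := hβ'.exists_aut hβC'
  have hαa : α ⟨a, hEC ha⟩ = ⟨a', hEC ha'⟩ := by
    refine Subtype.ext (Subtype.ext ?_)
    rw [hα', haa', ← extendAut_apply]
  have hmem : b' * α * b⁻¹ ∈ {α | α ∈ (generatedFusion (groupFusion S) S₀ Γ).Aut
      (centralizer (E : Set S.toSubgroup)) ∧ imageUnder α.toMonoidHom Z = Z} := by
    have hF := mul_mem (mul_mem hbF' hα) (inv_mem hb)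
    refine ⟨hF, ?_⟩
    have hZC : Z ≤ centralizer (E : Set S.toSubgroup) := D.le.trans (hUE.trans hEC)
    obtain ⟨f, hf, hfx⟩ := FusionSystem.exists_mor hF.1
    have hz1 : (b ⟨a, hEC ha⟩ : S.toSubgroup) ≠ 1 := fun h => ha1 (congrArg Subtype.val
      (b.injective ((Subtype.ext h : b ⟨a, hEC ha⟩ = 1).trans (map_one b).symm)))
    have hbZ : (b ⟨a, hEC ha⟩ : S.toSubgroup) ∈ Z := by
      rw [← coe_mem_map_subtype, hb']
      exact hβa
    refine imageUnder_eq_of_forall_mem hZC (MulEquiv.injective _) (fun x hx => ?_) le_rfl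
    rw [← hfx]
    refine hf.mapsTo_of_card_prime D.card_eq hZC hbZ hz1 ?_ x hx
    rw [hfx]
    change ((b' (α (b⁻¹ (b ⟨a, hEC ha⟩))) : centralizer (E : Set S.toSubgroup)) :
      S.toSubgroup) ∈ Z
    rw [MulAut.inv_apply_self, hαa, ← coe_mem_map_subtype, hbb']
    exact hβa'
  rw [D.aut E hE hUE hEc] at hmem
  obtain ⟨m, hm⟩ := mem_groupFusion_aut_iff.1 hmem
  refine ⟨fun x => β' (h * x * h⁻¹), ?_, hβt.conj m ?_⟩
  · have haγ : h * extendAut γ a * h⁻¹ = a' := by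
      rw [haa', ← extendAut_apply]
    refine D.isTransport_comp (f := β') (haγ.symm ▸ hβt') ?_ fun x _ => rfl
    rintro _ ⟨_, ⟨x, hx, rfl⟩, rfl⟩
    rw [subtype_apply, ← hα' ⟨x, hx⟩]
    exact coe_mem_map_subtype.2 (α _).2
  · rintro _ ⟨x, hx, rfl⟩
    have h4 := hm (b ⟨x, hx⟩)
    simp only [MulAut.mul_apply, MulAut.inv_apply_self] at h4
    rw [hbb', hα', hb'] at h4
    exact h4

/-- Each subgroup `E ≥ U` of rank three is `C_G(U)`-conjugate to a fully centralized one. -/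
theorem exists_fullyCentralized (hE : IsElementaryAbelianOfRank p 3 E) (hUE : U ≤ E) :
    ∃ c ∈ centralizer (ambient U : Set G), ∃ E' : Subgroup S.toSubgroup,
      IsElementaryAbelianOfRank p 3 E' ∧ U ≤ E' ∧ (groupFusion S).FullyCentralized E' ∧
      (∀ x ∈ E, ∃ y ∈ E', (y : G) = c * x * c⁻¹) ∧
      ∀ x ∈ centralizer (E : Set S.toSubgroup), ∃ y ∈ centralizer (E' : Set S.toSubgroup),
        (y : G) = c * x * c⁻¹ := by
  have hEC : E ≤ centralizer (E : Set S.toSubgroup) := fun x hx y hy => hE.1 y hy x hx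
  obtain ⟨T, hT, hTs⟩ := exists_isSylowIn_ge (isPGroup_map (centralizer (E : Set S.toSubgroup)))
    centralizer_map_le
  obtain ⟨hTC, hTp, -⟩ := isSylowIn_iff.1 hTs
  -- Since `U ≤ E`, the Sylow subgroup `T` of `C_G(E)` lies in `C_G(U)`, so the conjugator into `S₀`
  -- can be taken in `C_G(U)` and fixes `U`.
  obtain ⟨c, hc, hcT⟩ := D.sylow.exists_conj_mem
    (hTC.trans (Subgroup.centralizer_le (map_mono hUE))) hTp
  have hcS : ∀ t ∈ T, c * t * c⁻¹ ∈ S.toSubgroup := fun t ht => by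
    obtain ⟨y, -, hy⟩ := hcT t ht
    exact hy ▸ y.2
  obtain ⟨f, hf, hfc⟩ := exists_groupFusion_mor (S := S) (P := E) (g := c)
    fun x hx => hcS x (hT (coe_mem_map_subtype.2 (hEC hx)))
  obtain ⟨E', k1, k2⟩ := hf.exists_image
  have hE' := hE.of_conj (FusionSystem.conj_iff.2 ⟨f, hf, k1, k2⟩)
  have hTE' : ∀ t (ht : t ∈ T),
      (⟨c * t * c⁻¹, hcS t ht⟩ : S.toSubgroup) ∈ centralizer (E' : Set S.toSubgroup) := by
    intro t ht e he
    obtain ⟨e, he', rfl⟩ := k2 e he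
    have h1 := mem_centralizer_map_iff.1 (hTC ht) e he'
    refine Subtype.ext ?_
    rw [Subgroup.coe_mul, Subgroup.coe_mul, hfc e he']
    calc c * e * c⁻¹ * (c * t * c⁻¹) = c * (e * t) * c⁻¹ := by group
      _ = _ := by rw [h1]; group
  refine ⟨c, hc, E', hE', fun u hu => ?_, ?_, fun x hx => ⟨f x, k1 x hx, hfc x hx⟩,
    fun x hx => ⟨_, hTE' x (hT (coe_mem_map_subtype.2 hx)), rfl⟩⟩
  · have : f u = u := Subtype.ext ((hfc u (hUE hu)).trans (conj_eq_of_mem_centralizer hc hu))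
    exact this ▸ k1 u (hUE hu)
  · refine fullyCentralized_of_isSylowIn
      (isSylowIn_iff.2 ⟨centralizer_map_le, isPGroup_map _, fun A hA hAp hle => ?_⟩)
    have hA' : A.map (MulAut.conj c⁻¹).toMonoidHom ≤ centralizer (ambient E : Set G) := by
      rintro _ ⟨x, hx, rfl⟩
      refine mem_centralizer_map_iff.2 fun e he => ?_
      have h1 := mem_centralizer_map_iff.1 (hA hx) (f e) (k1 e he)
      rw [hfc e he] at h1
      change (e : G) * (c⁻¹ * x * c⁻¹⁻¹) = c⁻¹ * x * c⁻¹⁻¹ * e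
      calc _ = c⁻¹ * (c * e * c⁻¹ * x) * c := by group
        _ = _ := by rw [h1]; group
    obtain ⟨k, -, hk⟩ := hTs.exists_conj_mem hA' (hAp.map _)
    refine (eq_of_le_of_card_ge hle ?_).ge
    refine (card_le_of_conj_mem (B := T) (k * c⁻¹) fun x hx => ?_).trans
      (card_le_of_conj_mem c fun t ht => ⟨_, hTE' t ht, rfl⟩)
    convert hk _ ⟨x, hx, rfl⟩ using 1
    simp [mul_assoc]

/-- If `a ∉ U`, then `P` centralizes `E = ⟨a⟩U`, of rank three. Some `c ∈ C_G(U)` moves `E` to a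
fully centralized `E'`, and since `γ` preserves `C_G(U)`-fusion, passing from `E` to `E'` changes
the source and the target only by conjugations, which standard maps absorb. -/
theorem isCompatible_extendAut {γ : MulAut S₀} (hγ : γ ∈ Γ) {P : Set G} {a : G}
    (hP : ∀ x ∈ P, x ∈ ambient S₀) (haP : a ∈ P) (ha : IsCentralizedBy S P a) :
    IsCompatible Z U Γ P a (extendAut γ) := by
  obtain ⟨-, ha1, hap, hcomm⟩ := ha
  by_cases haU : a ∈ ambient U
  · exact D.isCompatible_extendAut_of_mem_U hγ hP haU ha1
  obtain ⟨a, haS₀, rfl⟩ := hP a haP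
  change IsCompatible Z U Γ P (a : G) _
  have haU' : a ∉ U := fun h => haU (coe_mem_map_subtype.2 h)
  have hE := D.rank_two.zpowers_sup (Subtype.ext hap) haU' (D.eq_centralizer ▸ haS₀)
  have haE : a ∈ zpowers a ⊔ U := mem_sup_left (mem_zpowers a)
  obtain ⟨c, hc, E', hE', hUE', hEc', h1, h2⟩ := D.exists_fullyCentralized hE le_sup_right
  obtain ⟨a', ha', haa'⟩ := h1 a haE
  have ha1' : a' ≠ 1 := by
    rintro rfl
    exact ha1 (by simpa [mul_inv_eq_one] using haa'.symm)
  obtain ⟨f, hf1, hf2⟩ := D.isCompatible_extendAut_of_fullyCentralized hE' hUE' hEc' ha' ha1' hγ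
  obtain ⟨c', -, hc'⟩ := D.exists_conj_apply hγ hc
  have hcP : ∀ x ∈ P, ∃ y y' : S₀, (y : G) = x ∧ (y' : G) = c * x * c⁻¹ ∧
      (y' : S.toSubgroup) ∈ centralizer (E' : Set S.toSubgroup) := by
    intro x hx
    have hxa := (hcomm x hx).2
    obtain ⟨x, hxS, rfl⟩ := hP x hx
    obtain ⟨y, hy, hyx⟩ := h2 x (by
      have : zpowers a ⊔ U ≤ centralizer {x} := by
        refine sup_le ((zpowers_le).2 (mem_centralizer_singleton_iff.2
          (Subtype.ext hxa.symm))) fun u hu => ?_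
        rw [D.eq_centralizer] at hxS
        exact mem_centralizer_singleton_iff.2 (hxS u hu)
      exact fun e he => mem_centralizer_singleton_iff.1 (this he))
    exact ⟨⟨x, hxS⟩, ⟨y, D.centralizer_le hUE' hy⟩, rfl, hyx, hy⟩
  have key : ∀ x ∈ P, c' * extendAut γ x * c'⁻¹ = extendAut γ (c * x * c⁻¹) := by
    intro x hx
    obtain ⟨y, y', rfl, hy', -⟩ := hcP x hx
    rw [← hy', extendAut_apply, extendAut_apply]
    exact (hc' y y' hy').symm
  have hcP' : ∀ x ∈ P, c * x * c⁻¹ ∈ ambient (centralizer (E' : Set S.toSubgroup)) := by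
    intro x hx
    obtain ⟨y, y', rfl, hy', hyE⟩ := hcP x hx
    rw [← hy']
    exact coe_mem_map_subtype.2 hyE
  refine ⟨fun x => f (c' * x * c'⁻¹), D.isTransport_comp (f := f) (g := c')
    (P' := extendAut γ '' ambient (centralizer (E' : Set S.toSubgroup))) ?_ ?_ fun x _ => rfl,
    D.isTransport_comp (f := f ∘ extendAut γ) (g := c) (haa' ▸ hf2) hcP' fun x hx => ?_⟩
  · have := key _ haP
    rw [subtype_apply] at this
    rw [this, ← haa']
    exact hf1
  · rintro _ ⟨x, hx, rfl⟩
    exact ⟨_, hcP' x hx, (key x hx).symm⟩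
  · rw [Function.comp_apply, Function.comp_apply, key x hx]

end IsRankTwoExtension

end Extension

/-! ### Compatibility of all morphisms and the conclusion -/

section Main

variable {G : Type u} [Group G] {p : ℕ} {S : Sylow p G} {Z U S₀ : Subgroup S.toSubgroup}
  {Γ : Subgroup (MulAut S₀)} {P Q : Subgroup S.toSubgroup}

theorem exists_extend_hom (φ : P →* Q) :
    ∃ k : G → G, ∀ x : P, k ((x : S.toSubgroup) : G) = ((φ x : S.toSubgroup) : G) :=
  ⟨Function.extend (fun x : P => ((x : S.toSubgroup) : G))
    (fun x => ((φ x : S.toSubgroup) : G)) 1,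
    (Subtype.val_injective.comp Subtype.val_injective).extend_apply _ _⟩

theorem IsCentralizedBy.image {P' : Set G} {a : G} (ha : IsCentralizedBy S P' a) (haP : a ∈ P')
    {φ : P →* Q} (hφ : Function.Injective φ) (hP : ∀ x ∈ P', ∃ y : P, (y : G) = x) {k : G → G}
    (hk : ∀ x : P, ((x : S.toSubgroup) : G) ∈ P' → k x = (φ x : S.toSubgroup)) :
    IsCentralizedBy S (k '' P') (k a) := by
  obtain ⟨-, ha1, hap, hc⟩ := ha
  obtain ⟨a, rfl⟩ := hP a haP
  rw [hk a haP]
  refine ⟨(φ a : S.toSubgroup).2, fun h => ha1 ?_, ?_, ?_⟩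
  · have h1 : φ a = 1 := Subtype.ext (Subtype.ext h)
    rw [hφ (h1.trans (map_one φ).symm)]
    rfl
  · have h1 : a ^ p = 1 := Subtype.ext (Subtype.ext hap)
    have h2 := congrArg (fun x => ((φ x : S.toSubgroup) : G)) h1
    simpa using h2
  · rintro _ ⟨x, hx, rfl⟩
    have hxa := (hc x hx).2
    obtain ⟨x, rfl⟩ := hP x hx
    rw [hk x hx]
    refine ⟨(φ x : S.toSubgroup).2, ?_⟩
    have h1 : x * a = a * x := Subtype.ext (Subtype.ext hxa)
    have h2 := congrArg (fun x => ((φ x : S.toSubgroup) : G)) h1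
    simpa using h2

namespace IsRankTwoExtension

variable (D : IsRankTwoExtension S Z U S₀ Γ) [Fact p.Prime] [Finite G]
include D

/-- Every morphism of the extended fusion system is compatible with the standard maps. -/
theorem isCompatible_of_genHom {φ : P →* Q} (hφ : GenHom (groupFusion S) S₀ Γ P Q φ) :
    ∀ (P' : Set G) (a : G) (k : G → G), a ∈ P' → IsCentralizedBy S P' a →
      (∀ x ∈ P', ∃ y : P, (y : G) = x) →
      (∀ x : P, ((x : S.toSubgroup) : G) ∈ P' → k x = (φ x : S.toSubgroup)) →
      IsCompatible Z U Γ P' a k := by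
  -- The statement ranges over all subsets `P'` and extensions `k`, so that for a composite it can
  -- be applied to the second factor on the image of `P'`.
  induction hφ with
  | base φ hφ =>
    intro P' a k haP ha hP hk
    have ha' := ha.image haP ((groupFusion S).injective hφ) hP hk
    obtain ⟨g, -, hg⟩ := hφ
    have hkg : ∀ x ∈ P', k x = g * x * g⁻¹ := fun x hx => by
      obtain ⟨y, rfl⟩ := hP x hx
      rw [hk y hx]
      exact hg y
    rw [Set.image_congr hkg, hkg a haP] at ha'
    exact (D.isCompatible_conj ha').congr haP hkg
  | restr hP₀ hQ₀ φ γ hγ _ hφ =>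
    intro P' a k haP ha hP hk
    refine (D.isCompatible_extendAut hγ (fun x hx => ?_) haP ha).congr haP fun x hx => ?_
    · obtain ⟨y, rfl⟩ := hP x hx
      exact coe_mem_map_subtype.2 (hP₀ y.2)
    · obtain ⟨y, rfl⟩ := hP x hx
      rw [hk y hx]
      exact (congrArg (fun z : S₀ => ((z : S.toSubgroup) : G)) (hφ y)).trans
        (extendAut_apply γ _).symm
  | comp φ ψ hφ hψ ih1 ih2 =>
    intro P' a k haP ha hP hk
    obtain ⟨k₁, hk₁⟩ := exists_extend_hom φ
    obtain ⟨k₂, hk₂⟩ := exists_extend_hom ψ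
    have h1 := ih1 P' a k₁ haP ha hP fun x _ => hk₁ x
    have ha' := ha.image haP ((generatedFusion (groupFusion S) S₀ Γ).injective hφ) hP
      fun x _ => hk₁ x
    have h2 := ih2 (k₁ '' P') (k₁ a) k₂ ⟨a, haP, rfl⟩ ha' (by
      rintro _ ⟨x, hx, rfl⟩
      obtain ⟨y, rfl⟩ := hP x hx
      exact ⟨φ y, (hk₁ y).symm⟩) fun x _ => hk₂ x
    refine (D.isCompatible_comp h1 h2).congr haP fun x hx => ?_
    obtain ⟨y, rfl⟩ := hP x hx
    rw [hk y hx, Function.comp_apply, hk₁, hk₂]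
    rfl

/-- For `z` and `f z` both in `Z`, the standard maps are conjugations by some `n` and `m`, and
compatibility reads `m (f x) m⁻¹ = n x n⁻¹`. -/
theorem groupFusion_mor {f : S.toSubgroup → S.toSubgroup} (hZP : Z ≤ P)
    (hf : (generatedFusion (groupFusion S) S₀ Γ).Mor P f) (hfZ : ∀ z ∈ Z, f z ∈ Z) :
    (groupFusion S).Mor P f := by
  obtain ⟨φ, hφ, hfφ⟩ := hf
  obtain ⟨k, hk⟩ := exists_extend_hom φ
  obtain ⟨z, hz, hz1, hzp⟩ := exists_ne_one_of_card_prime D.card_eq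
  have hkf : ∀ x ∈ P, k x = f x := fun x hx => by
    rw [hk ⟨x, hx⟩, hfφ ⟨x, hx⟩]
  have hcomp := D.isCompatible_of_genHom hφ (ambient P) z k (coe_mem_map_subtype.2 (hZP hz))
    ⟨z.2, fun h => hz1 (Subtype.ext h), congrArg Subtype.val hzp, by
      rintro _ ⟨x, -, rfl⟩
      exact ⟨x.2, congrArg Subtype.val (mem_center_iff.1 (D.Z_le_center hz) x)⟩⟩
    (by rintro _ ⟨x, hx, rfl⟩; exact ⟨⟨x, hx⟩, rfl⟩) fun x _ => hk x
  obtain ⟨f₀, h1, h2⟩ := hcomp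
  rw [hkf z (hZP hz)] at h1
  rcases h1 with ⟨-, m, hm⟩ | ⟨h, -⟩
  swap
  · exact absurd (coe_mem_map_subtype.2 (hfZ z hz)) h
  rcases h2 with ⟨-, n, hn⟩ | ⟨h, -⟩
  swap
  · exact absurd (coe_mem_map_subtype.2 hz) h
  refine groupFusion_mor_iff.2 ⟨m⁻¹ * n, fun x hx => ?_⟩
  have hx' : (x : G) ∈ (ambient P : Set G) := coe_mem_map_subtype.2 hx
  have h3 := (hm _ ⟨x, hx', rfl⟩).symm.trans (hn x hx')
  rw [← hkf x hx]
  calc k x = m⁻¹ * (m * k x * m⁻¹) * m := by group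
    _ = _ := by rw [h3]; group

theorem isCentralReduction :
    (generatedFusion (groupFusion S) S₀ Γ).IsCentralReduction (groupFusion S) Z where
  le := groupFusion_hom_le
  le_center := D.Z_le_center
  card_eq := D.card_eq
  mor P hZP f hf hfZ := D.groupFusion_mor hZP hf hfZ
  transport a ha1 hap := by
    by_cases haZ : a ∈ Z
    · exact ⟨id, FusionSystem.mor_id, haZ⟩
    obtain ⟨g, ⟨b, hb, hbU⟩, hg⟩ := D.exists_conj_mem_U hap haZ
    have hgC : ∀ x ∈ centralizer {a}, ∃ y : S₀, (y : G) = g * x * g⁻¹ := fun x hx =>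
      hg x (mem_centralizer_singleton_iff.1 hx)
    obtain ⟨γ, hγ, hγb⟩ := D.exists_apply_mem hbU fun h => ha1 (Subtype.ext (by
      have h3 : (a : G) = g⁻¹ * (b : G) * g := by rw [hb]; group
      rw [h3, h]
      simp))
    obtain ⟨f, hf, h⟩ := (ambientMor_extendAut hγ (le_refl S₀)).comp
      (ambientMor_conj (P := centralizer {a}) (g := g) fun x hx => by
        obtain ⟨y, hy⟩ := hgC x hx
        exact hy ▸ (y : S.toSubgroup).2) fun x hx => by
        obtain ⟨y, hy⟩ := hgC x hx
        exact ⟨y, y.2, hy⟩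
    refine ⟨f, hf, ?_⟩
    rw [← coe_mem_map_subtype, ← h a (mem_centralizer_singleton_iff.2 rfl), Function.comp_apply,
      ← hb, extendAut_apply]
    exact coe_mem_map_subtype.2 hγb

theorem setOf_hom_eq (hZP : Z ≤ P) :
    {φ | φ ∈ (generatedFusion (groupFusion S) S₀ Γ).Hom P ⊤ ∧ imageUnder φ Z = Z} =
      (groupFusion S).Hom P ⊤ := by
  ext φ
  constructor
  · rintro ⟨hφ, hZ⟩
    obtain ⟨f, hf, h⟩ := FusionSystem.exists_mor hφ
    refine (D.groupFusion_mor hZP hf fun z hz => ?_).hom_mem h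
    rw [h ⟨z, hZP hz⟩]
    exact hZ.le ⟨⟨z, hZP hz⟩, hz, rfl⟩
  · intro hφ
    refine ⟨groupFusion_hom_le _ _ hφ, imageUnder_eq_of_forall_mem hZP
      ((groupFusion S).injective hφ) (fun x hx => ?_) le_rfl⟩
    obtain ⟨g, -, hg⟩ := hφ
    have h1 := D.conj_mem_iff (g := g).2 (coe_mem_map_subtype.2 hx)
    rw [← subtype_apply, ← hg x] at h1
    exact coe_mem_map_subtype.1 h1

end IsRankTwoExtension

end Main

theorem proposition1p2 {G : Type u} [Group G] [Finite G] {p : ℕ} (hp : p.Prime)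
    (hpG : p ∣ Nat.card G) (S : Sylow p G)
    -- `Z ⊴ G` has order `p`, and `U ⊴ S` is elementary abelian of rank two and contains `Z`
    (Z U : Subgroup S.toSubgroup)
    (hZ : (Z.map S.toSubgroup.subtype).Normal) (hZp : Nat.card Z = p)
    (hU : U.Normal) (hU2 : IsElementaryAbelianOfRank p 2 U) (hZU : Z ≤ U)
    -- `S₀ = C_S(U)` is a Sylow `p`-subgroup of `C_G(U)`
    (S₀ : Subgroup S.toSubgroup) (hS₀ : S₀ = Subgroup.centralizer (U : Set S.toSubgroup))
    (hS₀G : IsSylowIn p (S₀.map S.toSubgroup.subtype)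
      (Subgroup.centralizer (U.map S.toSubgroup.subtype : Set G)))
    -- `Γ ≤ Aut(S₀)` preserves `C_G(U)`-fusion and `U`
    (Γ : Subgroup (MulAut S₀))
    (hΓ : ∀ γ ∈ Γ, PreservesFusion (S.toSubgroup.subtype.comp S₀.subtype)
      (Subgroup.centralizer (U.map S.toSubgroup.subtype : Set G)) γ)
    (hΓU : ∀ γ ∈ Γ, imageUnder γ.toMonoidHom U = U)
    (F : FusionSystem p S.toSubgroup) (hF : F = generatedFusion (groupFusion S) S₀ Γ)
    -- (a)
    (ha : ∀ A B : Subgroup S.toSubgroup, Nat.card A = p → Nat.card B = p → A ≠ Z → B ≠ Z →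
      AreConj S.toSubgroup.subtype A B)
    -- (b)
    (hb : ∀ A B : Subgroup S.toSubgroup, A ≤ U → B ≤ U → Nat.card A = p → Nat.card B = p →
      ∃ γ ∈ Γ, imageUnder γ.toMonoidHom A = B)
    -- (c)
    (hc : {φ : MulAut S₀ | φ ∈ Γ ∧ imageUnder φ.toMonoidHom Z = Z} =
      {φ : MulAut S₀ | φ.toMonoidHom ∈ conjHom S.toSubgroup.subtype
        (Subgroup.normalizer (U.map S.toSubgroup.subtype : Set G)) S₀ S₀})
    -- (d)
    (hd : ∀ E : Subgroup S.toSubgroup, IsElementaryAbelianOfRank p 3 E → U ≤ E →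
      (groupFusion S).FullyCentralized E →
      {α | α ∈ F.Aut (Subgroup.centralizer (E : Set S.toSubgroup)) ∧
        imageUnder α.toMonoidHom Z = Z} =
      {α | α ∈ (groupFusion S).Aut (Subgroup.centralizer (E : Set S.toSubgroup))})
    -- (e)
    (he : ∀ E E' : Subgroup S.toSubgroup, IsElementaryAbelianOfRank p 3 E →
      IsElementaryAbelianOfRank p 3 E' → U ≤ E → U ≤ E' →
      (∃ γ ∈ Γ, imageUnder γ.toMonoidHom E = E') → AreConj S.toSubgroup.subtype E E') :
    F.IsSaturated ∧
      ∀ P : Subgroup S.toSubgroup, Z ≤ P →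
        {φ | φ ∈ F.Hom P ⊤ ∧ imageUnder φ Z = Z} = (groupFusion S).Hom P ⊤ := by
  have := Fact.mk hp
  subst hF
  have D : IsRankTwoExtension S Z U S₀ Γ :=
    ⟨hZ, hZp, hU2, hZU, hS₀, hS₀G, hΓ, hΓU, ha, hb, hc, hd, he⟩
  exact ⟨D.isCentralReduction.isSaturated (groupFusion_isSaturated S), fun P => D.setOf_hom_eq⟩
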